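/- **Setting.** Let $\mathcal L$ be a (possibly many-sorted) first-order language with equality, all sorts of structures being nonempty, and let $T$ be a complete $\mathcal L$-theory, i.e. a maximal satisfiable set of sentences; $|T|$ is its cardinality. Fix a sort $h$; $x$ always denotes a nonempty finite tuple of distinct variables of sort $h$, and $l(x)$ its length. A partitioned formula $\phi(x,y)$ is an $\mathcal L$-formula whose free variables are split into $x$ and a disjoint finite tuple $y$ of parameter variables of arbitrary sorts. For a structure $M$, let $L_x(M)$ be the Boolean algebra of the subsets of $M_x$ (the set of $x$-tuples in $M$) that are definable with parameters from $M$, and for a set of parameters $A\subseteq M$ let $L_x(A,M)$ be the subalgebra of the sets definable over $A$. An ideal of $L_x(M)$ is a subset that contains $\emptyset$ and is closed under finite unions and definable subsets. A *$\bigvee$-definable ideal schema for $T$* in the variables $x$ is a map $J$ which assigns to each partitioned formula $\psi(x,y)$ a set $\neg Jx.\psi$ of formulas with free variables among those of $\psi$ that are not in $x$, such that for every $M\models T$: whether $c$ satisfies all formulas of $\neg Jx.\psi$ in $M$ depends only on the set $\psi(M,c)$, and the sets $\psi(M,c)$ for which $c$ does *not* satisfy all formulas of $\neg Jx.\psi$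 form an ideal $J(M)$ of $L_x(M)$. Let $S^J_x(A,M)$ be the set of complete $x$-types over $A$ in $M$ (ultrafilters of $L_x(A,M)$) that contain no member of $J(M)$. For $D\in L_x(M)$ put $R^{J(M)}(D,\phi,2)\ge 0$ if $D\notin J(M)$, and $R^{J(M)}(D,\phi,2)\ge m+1$ if for some $c$ in $M$ both $R^{J(M)}(D\cap\phi(M,c),\phi,2)\ge m$ and $R^{J(M)}(D\setminus\phi(M,c),\phi,2)\ge m$. A formula $\phi(x,y)$ is *$J$-stable* (in $T$) if for every $M\models T$ there is $m\in\omega$ such that $R^{J(M)}(M_x,\phi,2)\ge m$ fails. For ideals $K\subseteq L_x(M)$ and $K'\subseteq L_{x'}(M)$, with $x,x'$ disjoint, $K\otimes K'$ is the set of all $D\in L_{x x'}(M)$ for which there is $F\in K$ with $\{a\in M_x : D_a\notin K'\}\subseteq F$, where $D_a=\{b : ab\in D\}$. Put $K^{\otimes 1}=K$ and $K^{\otimes (n+1)}=K^{\otimes n}\otimes K$. **Theorem.** Let $I$ be a $\bigvee$-definable ideal schema for $T$ in one free variable, of sort $h$. For every $n\ge 1$ there is a $\bigvee$-definable ideal schema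 for $T$ in $n$ variables of sort $h$ whose $\mathfrak U$-points are $I(\mathfrak U)^{\otimes n}$ for every $\omega$-saturated $\mathfrak U\models T$. Fix an $\omega$-saturated $\mathfrak U\models T$, and let $I^{\otimes n}$ denote any $\bigvee$-definable ideal schema for $T$ with $I^{\otimes n}(\mathfrak U)=I(\mathfrak U)^{\otimes n}$. Write $S^I_n(A,M)$ for $S^{I^{\otimes n}}_x(A,M)$ with $l(x)=n$, where $S^I_1(A,M)=S^{I}_x(A,M)$. The following are equivalent: (a) every partitioned formula $\phi(x,y)$ is $I^{\otimes l(x)}$-stable; (b) every partitioned formula $\phi(x,y)$ with $l(x)=1$ is $I$-stable; (c) for every infinite cardinal $\lambda$ with $\lambda=\lambda^{|T|}$, every $M\models T$ and every $A\subseteq M$: if $|A|\le\lambda$, then $|S^I_1(A,M)|\le\lambda$; (d) for every infinite cardinal $\lambda$ with $\lambda=\lambda^{|T|}$, every $M\models T$, every $A\subseteq M$ and every $n\ge 1$: if $|A|\le\lambda$, then $|S^I_n(A,M)|\le\lambda$. -/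

import Mathlib

set_option linter.checkUnivs false

universe u v w

namespace WideStability

/-! ### Many-sorted first-order logic -/

/-- A many-sorted signature (equality is a logical symbol).  A function symbol has a finite list of
argument sorts and a value sort, a relation symbol has a finite list of argument sorts. -/
structure Signature : Type (max (u + 1) (v + 1)) where
  Srt : Type u
  Fn : {n : ℕ} → (Fin n → Srt) → Srt → Type v
  Rl : {n : ℕ} → (Fin n → Srt) → Type v

/-- The variables: countably many in each sort. -/
abbrev Var (σ : Signature.{u, v}) : Type u := σ.Srt × ℕ

inductive Term (σ : Signature.{u, v}) : σ.Srt → Type (max u v)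
  | var (s : σ.Srt) (i : ℕ) : Term σ s
  | app {n : ℕ} {d : Fin n → σ.Srt} {s : σ.Srt} (f : σ.Fn d s)
      (ts : ∀ i : Fin n, Term σ (d i)) : Term σ s

inductive Formula (σ : Signature.{u, v}) : Type (max u v)
  | falsum : Formula σ
  | eq {s : σ.Srt} (t t' : Term σ s) : Formula σ
  | rel {n : ℕ} {d : Fin n → σ.Srt} (R : σ.Rl d) (ts : ∀ i : Fin n, Term σ (d i)) : Formula σ
  | imp (φ ψ : Formula σ) : Formula σ
  | all (s : σ.Srt) (i : ℕ) (φ : Formula σ) : Formula σ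

/-- Variables of a term. -/
def Term.fv {σ : Signature.{u, v}} : {s : σ.Srt} → Term σ s → Set (Var σ)
  | _, .var s i => {(s, i)}
  | _, .app _ ts => ⋃ i, (ts i).fv

/-- Free variables of a formula. -/
def Formula.fv {σ : Signature.{u, v}} : Formula σ → Set (Var σ)
  | .falsum => ∅
  | .eq t t' => t.fv ∪ t'.fv
  | .rel _ ts => ⋃ i, (ts i).fv
  | .imp φ ψ => φ.fv ∪ ψ.fv
  | .all s i φ => φ.fv \ {(s, i)}

/-- Negation. -/
def Formula.neg {σ : Signature.{u, v}} (φ : Formula σ) : Formula σ := φ.imp .falsum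

abbrev Sentence (σ : Signature.{u, v}) : Type (max u v) := {φ : Formula σ // φ.fv = ∅}

def Sentence.neg {σ : Signature.{u, v}} (φ : Sentence σ) : Sentence σ :=
  ⟨φ.1.neg, by simp [Formula.neg, Formula.fv, φ.2]⟩

abbrev Theory (σ : Signature.{u, v}) : Type (max u v) := Set (Sentence σ)

/-- A structure; as usual, every sort is nonempty. -/
structure Str (σ : Signature.{u, v}) : Type (max u v (w + 1)) where
  carrier : σ.Srt → Type w
  nonempty : ∀ s, Nonempty (carrier s)
  fn : ∀ {n : ℕ} {d : Fin n → σ.Srt} {s : σ.Srt},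
    σ.Fn d s → (∀ i : Fin n, carrier (d i)) → carrier s
  rl : ∀ {n : ℕ} {d : Fin n → σ.Srt}, σ.Rl d → (∀ i : Fin n, carrier (d i)) → Prop

/-- Assignments of values to all variables. -/
abbrev Str.Val {σ : Signature.{u, v}} (M : Str.{u, v, w} σ) : Type (max u w) :=
  ∀ z : Var σ, M.carrier z.1

def Term.realize {σ : Signature.{u, v}} {M : Str.{u, v, w} σ} (e : M.Val) :
    {s : σ.Srt} → Term σ s → M.carrier s
  | _, .var s i => e (s, i)
  | _, .app f ts => M.fn f fun i => (ts i).realize e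

open Classical in
def Formula.Realize {σ : Signature.{u, v}} {M : Str.{u, v, w} σ} : Formula σ → M.Val → Prop
  | .falsum, _ => False
  | .eq t t', e => t.realize e = t'.realize e
  | .rel R ts, e => M.rl R fun i => (ts i).realize e
  | .imp φ ψ, e => φ.Realize e → ψ.Realize e
  | .all s i φ, e => ∀ a : M.carrier s, φ.Realize (Function.update e ((s, i) : Var σ) a)

def Str.IsModel {σ : Signature.{u, v}} (M : Str.{u, v, w} σ) (T : Theory σ) : Prop :=
  ∀ φ ∈ T, ∀ e : M.Val, φ.1.Realize e

/-- `T` is complete, i.e. maximal satisfiable. -/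
def Theory.IsMaximal {σ : Signature.{u, v}} (T : Theory σ) : Prop :=
  (∃ M : Str.{u, v, w} σ, M.IsModel T) ∧ ∀ φ : Sentence σ, φ ∈ T ∨ φ.neg ∈ T

/-- `M` is `ω`-saturated.  Here `X` is a finite tuple of variables, and a set `p` of formulas in
`X` over a finite set of parameters is given by formulas whose free variables lie in a fixed finite
set `V`, those outside `X` being interpreted as the parameters by the assignment `e`. If every
finite subset of `p` is satisfied in `M` by some `X`-tuple, then so is `p`. -/
def Str.IsOmegaSaturated {σ : Signature.{u, v}} (M : Str.{u, v, w} σ) : Prop :=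
  ∀ (X V : Finset (Var σ)) (p : Set (Formula σ)) (e : M.Val),
    (∀ φ ∈ p, φ.fv ⊆ V) →
    (∀ q : Finset (Formula σ), (q : Set (Formula σ)) ⊆ p →
      ∃ e' : M.Val, (∀ z, z ∉ X → e' z = e z) ∧ ∀ φ ∈ q, φ.Realize e') →
    ∃ e' : M.Val, (∀ z, z ∉ X → e' z = e z) ∧ ∀ φ ∈ p, φ.Realize e'

/-! ### Definable sets and complete types in a tuple of variables of one sort -/

/-- The context `x = (x₀, …, xₙ₋₁)` of the first `n` variables of sort `h`.  A partitioned formula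
`φ(x, y)` in this context is a formula `φ`, the parameter variables `y` being all others. -/
def ctx {σ : Signature.{u, v}} (h : σ.Srt) (n : ℕ) : Set (Var σ) := {z | z.1 = h ∧ z.2 < n}

/-- The assignment that sends `xᵢ` to `a i` for `i < n`, and is equal to `e` elsewhere. -/
noncomputable def Str.Val.set {σ : Signature.{u, v}} {M : Str.{u, v, w} σ} {h : σ.Srt} {n : ℕ} (e : M.Val)
    (a : Fin n → M.carrier h) : M.Val := fun z =>
  open Classical in
  if hz : z.1 = h ∧ z.2 < n then hz.1.symm ▸ a ⟨z.2, hz.2⟩ else e z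

/-- The set `φ(M, c)` of `n`-tuples defined by the instance of `φ(x, y)` in which the parameter
variables `y` take their values `c` from `e`. -/
def Str.solSet {σ : Signature.{u, v}} (M : Str.{u, v, w} σ) (h : σ.Srt) (n : ℕ) (φ : Formula σ)
    (e : M.Val) : Set (Fin n → M.carrier h) := {a | φ.Realize (e.set a)}

/-- Sets of parameters: subsets of the domain (the disjoint union of all sorts). -/
abbrev Str.Params {σ : Signature.{u, v}} (M : Str.{u, v, w} σ) : Type (max u w) :=
  Set (Σ s, M.carrier s)

/-- The algebra of sets of `n`-tuples of sort `h` that are definable over `A` in `M`. -/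
def Str.Def {σ : Signature.{u, v}} (M : Str.{u, v, w} σ) (h : σ.Srt) (n : ℕ) (A : M.Params) :
    Set (Set (Fin n → M.carrier h)) :=
  {D | ∃ (φ : Formula σ) (e : M.Val),
    (∀ z ∈ φ.fv \ ctx h n, (⟨z.1, e z⟩ : Σ s, M.carrier s) ∈ A) ∧ D = M.solSet h n φ e}

/-- `K` is an ideal of the Boolean algebra of definable sets of `n`-tuples of sort `h`. -/
structure Str.IsIdeal {σ : Signature.{u, v}} (M : Str.{u, v, w} σ) (h : σ.Srt) (n : ℕ)
    (K : Set (Set (Fin n → M.carrier h))) : Prop where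
  subset_def : K ⊆ M.Def h n Set.univ
  empty_mem : ∅ ∈ K
  mem_of_subset : ∀ D ∈ K, ∀ E ∈ M.Def h n Set.univ, E ⊆ D → E ∈ K
  union_mem : ∀ D ∈ K, ∀ E ∈ K, D ∪ E ∈ K

/-- Complete `n`-types over `A` in variables of sort `h`, as ultrafilters on the Boolean algebra of
`A`-definable sets. -/
structure Str.IsCompleteType {σ : Signature.{u, v}} (M : Str.{u, v, w} σ) (h : σ.Srt) (n : ℕ)
    (A : M.Params) (p : Set (Set (Fin n → M.carrier h))) : Prop where
  subset_def : p ⊆ M.Def h n A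
  empty_notMem : ∅ ∉ p
  inter_mem : ∀ D ∈ p, ∀ E ∈ p, D ∩ E ∈ p
  mem_of_subset : ∀ D ∈ p, ∀ E ∈ M.Def h n A, D ⊆ E → E ∈ p
  mem_or_compl_mem : ∀ D ∈ M.Def h n A, D ∈ p ∨ Dᶜ ∈ p

/-- The space of complete `n`-types over `A` that are wide, i.e. disjoint from `K`. -/
def Str.wideTypes {σ : Signature.{u, v}} (M : Str.{u, v, w} σ) (h : σ.Srt) (n : ℕ)
    (K : Set (Set (Fin n → M.carrier h))) (A : M.Params) :
    Set (Set (Set (Fin n → M.carrier h))) :=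
  {p | M.IsCompleteType h n A p ∧ Disjoint p K}

/-! ### `⋁`-definable ideal schemas -/

/-- A `⋁`-preschema of partial types in the context `x` of the first `n` variables of sort `h`:
it assigns to `ψ(x, y)` a set `¬Ix.ψ` of formulas in the variables `y`. -/
structure VPreschema (σ : Signature.{u, v}) (h : σ.Srt) (n : ℕ) : Type (max u v) where
  notI : Formula σ → Set (Formula σ)
  fv_subset : ∀ ψ, ∀ θ ∈ notI ψ, θ.fv ⊆ ψ.fv \ ctx h n

/-- `M ⊨ ¬Ix.ψ(x, c)`, where `c` is read off from `e`. -/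
def VPreschema.Wide {σ : Signature.{u, v}} {h : σ.Srt} {n : ℕ} (I : VPreschema σ h n)
    {M : Str.{u, v, w} σ} (ψ : Formula σ) (e : M.Val) : Prop :=
  ∀ θ ∈ I.notI ψ, θ.Realize e

/-- `I` is `∼_M`-invariant. -/
def VPreschema.Invariant {σ : Signature.{u, v}} {h : σ.Srt} {n : ℕ} (I : VPreschema σ h n)
    (M : Str.{u, v, w} σ) : Prop :=
  ∀ (ψ θ : Formula σ) (c d : M.Val), M.solSet h n ψ c = M.solSet h n θ d →
    (I.Wide ψ c ↔ I.Wide θ d)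

/-- The `M`-points `I(M)` of `I`. -/
def VPreschema.points {σ : Signature.{u, v}} {h : σ.Srt} {n : ℕ} (I : VPreschema σ h n)
    (M : Str.{u, v, w} σ) : Set (Set (Fin n → M.carrier h)) :=
  {D | ∃ (ψ : Formula σ) (c : M.Val), D = M.solSet h n ψ c ∧ ¬ I.Wide ψ c}

/-- `I` is a `⋁`-definable ideal schema for `T`: it `⋁`-defines an ideal in every model of `T`. -/
def VPreschema.IsIdealSchema {σ : Signature.{u, v}} {h : σ.Srt} {n : ℕ} (I : VPreschema σ h n)
    (T : Theory σ) : Prop :=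
  ∀ M : Str.{u, v, w} σ, M.IsModel T → I.Invariant M ∧ M.IsIdeal h n (I.points M)

/-! ### Fubini products -/

/-- The product `I ⊗ J`: the definable sets `D` of `(n + k)`-tuples for which some `F ∈ I` contains
every `a` whose fibre `D_a` is not in `J`. -/
def Str.fubini {σ : Signature.{u, v}} (M : Str.{u, v, w} σ) (h : σ.Srt) {n k : ℕ}
    (I : Set (Set (Fin n → M.carrier h))) (J : Set (Set (Fin k → M.carrier h))) :
    Set (Set (Fin (n + k) → M.carrier h)) :=
  {D | D ∈ M.Def h (n + k) Set.univ ∧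
    ∃ F ∈ I, {a : Fin n → M.carrier h | {b : Fin k → M.carrier h | Fin.append a b ∈ D} ∉ J} ⊆ F}

/-- `M.fubiniPow h I n` is the power `I^{⊗(n+1)}`: `I^{⊗1} = I` and
`I^{⊗(n+2)} = I^{⊗(n+1)} ⊗ I`. -/
def Str.fubiniPow {σ : Signature.{u, v}} (M : Str.{u, v, w} σ) (h : σ.Srt)
    (I : Set (Set (Fin 1 → M.carrier h))) : (n : ℕ) → Set (Set (Fin (n + 1) → M.carrier h))
  | 0 => I
  | n + 1 => M.fubini h (M.fubiniPow h I n) I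

/-! ### Rank and stability of a formula -/

/-- `R^K(D, φ, 2) ≥ m`, for a definable set `D` of `n`-tuples and an ideal `K`. -/
def Str.RankGE {σ : Signature.{u, v}} (M : Str.{u, v, w} σ) (h : σ.Srt) (n : ℕ)
    (K : Set (Set (Fin n → M.carrier h))) (φ : Formula σ) :
    ℕ → Set (Fin n → M.carrier h) → Prop
  | 0, D => D ∉ K
  | m + 1, D => ∃ c : M.Val, M.RankGE h n K φ m (D ∩ M.solSet h n φ c) ∧
      M.RankGE h n K φ m (D ∩ (M.solSet h n φ c)ᶜ)

/-- `φ(x, y)` is `I`-stable in `T`: in every model `M` of `T`, the rank `R^{I(M)}(x = x, φ, 2)` is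
less than `∞`, i.e. it is not `≥ m` for all `m`. -/
def VPreschema.IsStable {σ : Signature.{u, v}} {h : σ.Srt} {n : ℕ} (I : VPreschema σ h n)
    (T : Theory σ) (φ : Formula σ) : Prop :=
  ∀ M : Str.{u, v, w} σ, M.IsModel T → ∃ m : ℕ, ¬ M.RankGE h n (I.points M) φ m Set.univ

end WideStability

/-! The implications run (a) → (b) → (c) → (d) → (a); the first is the case of one variable.

Stability bounds the number of types by the rank argument of `Str.mk_wideTypes_le`. For each formula
φ choose in a wide type a member of least φ-rank. Two types that share this member and disagree
about an instance of φ split it into two pieces of the same rank, which would raise its rank. So a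
wide type is determined by its choices, of which there are at most λ^|T| = λ over a set of at most λ
parameters.

Conversely, let λ = 2^|T| and let μ be least with 2^μ > λ. Unbounded rank gives binary trees of
instances of every finite height whose branches are not covered by a set of the ideal. An ultrapower
glues them to a tree of height μ with at most λ nodes and more than λ branches, and distinct
branches extend to distinct wide types (`VPreschema.IsIdealSchema.exists_lt_mk_wideTypes`).

Products J ⊗ I are treated through generic fibres. For an ultrafilter 𝒰 on the n-tuples of M, the
fibres of a definable D form an internal definable set in the ultrapower of M by 𝒰: the fibre over
the generic tuple. By Łoś, it is I-wide iff each formula expressing that the fibre of D is wide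
holds 𝒰-almost everywhere. In every model, the product schema then defines the ideal of those D for
which some F in J belongs to all 𝒰 with wide generic fibre; compactness translates this into a
finite condition (`VPreschema.IsIdealSchema.not_wide_prod_iff`). In an ω-saturated model this ideal
is the Fubini product.

For (c) → (d), extend the restriction to n variables of a wide (n+1)-type to an ultrafilter 𝒰. The
generic fibres of the members of the type generate a wide partial 1-type over A and the generic
tuple, and distinct types with the same restriction give contradictory partial types
(`VPreschema.IsIdealSchema.mk_restrictType_le`). So each restriction has at most λ extensions, and
induction on n applies. Since T is complete, schemas that agree in one ω-saturated model agree in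
all models, so any choice of the powers may be replaced by the constructed one. -/

namespace WideStability

/-! ### Syntax, assignments and the algebra of definable sets -/

variable {σ : Signature.{u, v}}

/-! ### Renaming of variables -/

def Term.rename (f : σ.Srt → ℕ → ℕ) : {s : σ.Srt} → Term σ s → Term σ s
  | _, .var s i => .var s (f s i)
  | _, .app g ts => .app g fun i => (ts i).rename f

/-- Bound variables are renamed along with the free ones. For maps that are injective in each sort
no variable is captured, so capture-avoiding substitution is never needed. -/
def Formula.rename (f : σ.Srt → ℕ → ℕ) : Formula σ → Formula σ
  | .falsum => .falsum
  | .eq t t' => .eq (t.rename f) (t'.rename f)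
  | .rel R ts => .rel R fun i => (ts i).rename f
  | .imp φ ψ => .imp (φ.rename f) (ψ.rename f)
  | .all s i φ => .all s (f s i) (φ.rename f)

/-- The action on variables of a family of maps on indices. -/
def Var.map (f : σ.Srt → ℕ → ℕ) (z : Var σ) : Var σ := (z.1, f z.1 z.2)

/-- The assignment `e ∘ f`. -/
def Str.Val.comap {M : Str.{u, v, w} σ} (e : M.Val) (f : σ.Srt → ℕ → ℕ) : M.Val :=
  fun z => e (z.1, f z.1 z.2)

theorem Term.realize_rename {M : Str.{u, v, w} σ} (f : σ.Srt → ℕ → ℕ) (e : M.Val) {s : σ.Srt}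
    (t : Term σ s) : (t.rename f).realize e = t.realize (e.comap f) := by
  induction t with
  | var s i => rfl
  | app g ts ih => simp only [Term.rename, Term.realize, ih]

theorem Var.map_injective {f : σ.Srt → ℕ → ℕ} (hf : ∀ s, (f s).Injective) :
    (Var.map f).Injective := by
  rintro ⟨s, i⟩ ⟨t, j⟩ h
  simp only [Var.map, Prod.mk.injEq] at h
  obtain ⟨rfl, h⟩ := h
  rw [hf s h]

open Classical in
theorem Str.Val.comap_update {M : Str.{u, v, w} σ} (e : M.Val) {f : σ.Srt → ℕ → ℕ}
    (hf : ∀ s, (f s).Injective) (s : σ.Srt) (i : ℕ) (a : M.carrier s) :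
    Str.Val.comap (M := M) (Function.update e ((s, f s i) : Var σ) a) f =
      Function.update (e.comap f) ((s, i) : Var σ) a := by
  funext ⟨t, j⟩
  by_cases h : ((t, j) : Var σ) = (s, i)
  · cases h
    simp [Str.Val.comap]
  · rw [Function.update_of_ne h]
    have : ((t, f t j) : Var σ) ≠ (s, f s i) := fun h' => h (Var.map_injective hf h')
    simp only [Str.Val.comap]
    rw [Function.update_of_ne this]

theorem Formula.realize_rename {M : Str.{u, v, w} σ} {f : σ.Srt → ℕ → ℕ}
    (hf : ∀ s, (f s).Injective) (φ : Formula σ) (e : M.Val) :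
    (φ.rename f).Realize e ↔ φ.Realize (e.comap f) := by
  induction φ generalizing e with
  | falsum => rfl
  | eq t t' => simp only [Formula.rename, Formula.Realize, Term.realize_rename]
  | rel R ts => simp only [Formula.rename, Formula.Realize, Term.realize_rename]
  | imp φ ψ ih ih' => simp only [Formula.rename, Formula.Realize, ih, ih']
  | all s i φ ih =>
    simp only [Formula.rename, Formula.Realize, ih, Str.Val.comap_update e hf]

theorem Term.fv_rename (f : σ.Srt → ℕ → ℕ) {s : σ.Srt} (t : Term σ s) :
    (t.rename f).fv = Var.map f '' t.fv := by
  induction t with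
  | var s i => simp [Term.rename, Term.fv, Var.map]
  | app g ts ih => simp only [Term.rename, Term.fv, ih, Set.image_iUnion]

theorem Formula.fv_rename {f : σ.Srt → ℕ → ℕ} (hf : ∀ s, (f s).Injective) (φ : Formula σ) :
    (φ.rename f).fv = Var.map f '' φ.fv := by
  induction φ with
  | falsum => simp [Formula.rename, Formula.fv]
  | eq t t' => simp only [Formula.rename, Formula.fv, Term.fv_rename, Set.image_union]
  | rel R ts => simp only [Formula.rename, Formula.fv, Term.fv_rename, Set.image_iUnion]
  | imp φ ψ ih ih' => simp only [Formula.rename, Formula.fv, ih, ih', Set.image_union]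
  | all s i φ ih =>
    simp only [Formula.rename, Formula.fv, ih, Set.image_sdiff (Var.map_injective hf),
      Set.image_singleton]
    rfl

/-! ### Free variables -/

theorem Term.finite_fv {s : σ.Srt} (t : Term σ s) : t.fv.Finite := by
  induction t with
  | var s i => simp [Term.fv]
  | app g ts ih => exact Set.finite_iUnion ih

theorem Formula.finite_fv (φ : Formula σ) : φ.fv.Finite := by
  induction φ with
  | falsum => simp [Formula.fv]
  | eq t t' => exact t.finite_fv.union t'.finite_fv
  | rel R ts => exact Set.finite_iUnion fun i => (ts i).finite_fv
  | imp φ ψ ih ih' => exact ih.union ih'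
  | all s i φ ih => exact ih.sdiff

theorem Term.realize_congr {M : Str.{u, v, w} σ} {e e' : M.Val} {s : σ.Srt} (t : Term σ s)
    (h : ∀ z ∈ t.fv, e z = e' z) : t.realize e = t.realize e' := by
  induction t with
  | var s i => exact h _ rfl
  | app g ts ih =>
    simp only [Term.realize]
    congr 1
    funext i
    exact ih i fun z hz => h z (Set.mem_iUnion.2 ⟨i, hz⟩)

theorem Formula.realize_congr {M : Str.{u, v, w} σ} (φ : Formula σ) {e e' : M.Val}
    (h : ∀ z ∈ φ.fv, e z = e' z) : φ.Realize e ↔ φ.Realize e' := by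
  induction φ generalizing e e' with
  | falsum => rfl
  | eq t t' =>
    simp only [Formula.Realize]
    rw [t.realize_congr fun z hz => h z (Or.inl hz), t'.realize_congr fun z hz => h z (Or.inr hz)]
  | rel R ts =>
    simp only [Formula.Realize]
    have : (fun i => (ts i).realize e) = fun i => (ts i).realize e' :=
      funext fun i => (ts i).realize_congr fun z hz => h z (Set.mem_iUnion.2 ⟨i, hz⟩)
    rw [this]
  | imp φ ψ ih ih' =>
    simp only [Formula.Realize]
    rw [ih fun z hz => h z (Or.inl hz), ih' fun z hz => h z (Or.inr hz)]
  | all s i φ ih =>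
    simp only [Formula.Realize]
    classical
    refine forall_congr' fun a => ih fun z hz => ?_
    by_cases hzs : z = (s, i)
    · subst hzs; simp
    · rw [Function.update_of_ne hzs, Function.update_of_ne hzs]
      exact h z ⟨hz, hzs⟩

/-! ### Connectives -/

def Formula.and (φ ψ : Formula σ) : Formula σ := (φ.imp ψ.neg).neg

def Formula.conj : List (Formula σ) → Formula σ
  | [] => Formula.falsum.neg
  | φ :: l => φ.and (Formula.conj l)

def Formula.exs : List (Var σ) → Formula σ → Formula σ
  | [], φ => φ
  | z :: l, φ => (Formula.all z.1 z.2 (Formula.exs l φ).neg).neg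

def Formula.alls : List (Var σ) → Formula σ → Formula σ
  | [], φ => φ
  | z :: l, φ => Formula.all z.1 z.2 (Formula.alls l φ)

@[simp] theorem Formula.realize_neg {M : Str.{u, v, w} σ} (φ : Formula σ) (e : M.Val) :
    φ.neg.Realize e ↔ ¬ φ.Realize e := Iff.rfl

@[simp] theorem Formula.realize_and {M : Str.{u, v, w} σ} (φ ψ : Formula σ) (e : M.Val) :
    (φ.and ψ).Realize e ↔ φ.Realize e ∧ ψ.Realize e := by
  simp [Formula.and, Formula.Realize]

@[simp] theorem Formula.realize_conj {M : Str.{u, v, w} σ} (l : List (Formula σ)) (e : M.Val) :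
    (Formula.conj l).Realize e ↔ ∀ φ ∈ l, φ.Realize e := by
  induction l with
  | nil => simp [Formula.conj, Formula.Realize]
  | cons φ l ih => simp [Formula.conj, ih]

@[simp] theorem Formula.fv_neg (φ : Formula σ) : φ.neg.fv = φ.fv := by
  simp [Formula.neg, Formula.fv]

@[simp] theorem Formula.fv_and (φ ψ : Formula σ) : (φ.and ψ).fv = φ.fv ∪ ψ.fv := by
  simp [Formula.and, Formula.fv]

theorem Formula.fv_conj_subset {l : List (Formula σ)} {S : Set (Var σ)}
    (h : ∀ φ ∈ l, φ.fv ⊆ S) : (Formula.conj l).fv ⊆ S := by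
  induction l with
  | nil => simp [Formula.conj, Formula.fv]
  | cons φ l ih =>
    simp only [List.mem_cons, forall_eq_or_imp] at h
    simpa [Formula.conj] using ⟨h.1, ih h.2⟩

theorem Formula.fv_alls (l : List (Var σ)) (φ : Formula σ) :
    (Formula.alls l φ).fv = φ.fv \ {z | z ∈ l} := by
  induction l with
  | nil => simp [Formula.alls]
  | cons z l ih =>
    simp only [Formula.alls, Formula.fv, ih]
    ext y
    simp only [Set.mem_sdiff, Set.mem_ofPred_eq, List.mem_cons, Set.mem_singleton_iff, Prod.mk.eta]
    tauto

theorem Formula.fv_exs (l : List (Var σ)) (φ : Formula σ) :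
    (Formula.exs l φ).fv = φ.fv \ {z | z ∈ l} := by
  induction l with
  | nil => simp [Formula.exs]
  | cons z l ih =>
    simp only [Formula.exs, Formula.fv_neg, Formula.fv, ih]
    ext y
    simp only [Set.mem_sdiff, Set.mem_ofPred_eq, List.mem_cons, Set.mem_singleton_iff, Prod.mk.eta]
    tauto

theorem Formula.realize_exs {M : Str.{u, v, w} σ} (l : List (Var σ)) (φ : Formula σ) (e : M.Val) :
    (Formula.exs l φ).Realize e ↔ ∃ e' : M.Val, (∀ z, z ∉ l → e' z = e z) ∧ φ.Realize e' := by
  classical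
  induction l generalizing e with
  | nil =>
    constructor
    · exact fun h => ⟨e, fun _ _ => rfl, h⟩
    · rintro ⟨e', h, h'⟩
      rwa [show e' = e from funext fun z => h z (by simp)] at h'
  | cons y l ih =>
    simp only [Formula.exs, Formula.realize_neg, Formula.Realize, ih, not_forall, not_not]
    constructor
    · rintro ⟨a, e', h, h'⟩
      refine ⟨e', fun z hz => ?_, h'⟩
      simp only [List.mem_cons, not_or] at hz
      rw [h z hz.2, Function.update_of_ne hz.1]
    · rintro ⟨e', h, h'⟩
      refine ⟨e' y, e', fun z hz => ?_, h'⟩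
      by_cases hzy : z = y
      · subst hzy; simp
      · rw [Function.update_of_ne hzy]
        exact h z (by simp [hzy, hz])

/-! ### Assignments of a tuple -/

variable {M : Str.{u, v, w} σ} {h : σ.Srt} {n : ℕ}

theorem Str.Val.set_apply (e : M.Val) (a : Fin n → M.carrier h) {i : ℕ} (hi : i < n) :
    e.set a (h, i) = a ⟨i, hi⟩ := by
  simp [Str.Val.set, hi]

theorem Str.Val.set_of_notMem (e : M.Val) (a : Fin n → M.carrier h) {z : Var σ}
    (hz : z ∉ ctx h n) : e.set a z = e z := by
  have : ¬ (z.1 = h ∧ z.2 < n) := hz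
  simp [Str.Val.set, this]

/-- A property of all variables may be checked on the context and outside of it. -/
theorem Str.Val.ctx_cases {P : Var σ → Prop} (h : σ.Srt) (n : ℕ) (h1 : ∀ i < n, P (h, i))
    (h2 : ∀ z, z ∉ ctx h n → P z) (z : Var σ) : P z := by
  by_cases hz : z ∈ ctx h n
  · obtain ⟨s, i⟩ := z
    obtain ⟨rfl, hi⟩ : s = h ∧ i < n := hz
    exact h1 i hi
  · exact h2 z hz

theorem Str.Val.set_congr {e e' : M.Val} {S : Set (Var σ)}
    (he : ∀ z ∈ S \ ctx h n, e z = e' z) (a : Fin n → M.carrier h) :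
    ∀ z ∈ S, e.set a z = e'.set a z := by
  refine Str.Val.ctx_cases (P := fun z => z ∈ S → e.set a z = e'.set a z) h n
    (fun i hi _ => ?_) (fun z hz hzS => ?_)
  · rw [set_apply _ _ hi, set_apply _ _ hi]
  · rw [set_of_notMem _ _ hz, set_of_notMem _ _ hz]
    exact he z ⟨hzS, hz⟩

theorem Str.solSet_congr (φ : Formula σ) {e e' : M.Val}
    (he : ∀ z ∈ φ.fv \ ctx h n, e z = e' z) : M.solSet h n φ e = M.solSet h n φ e' :=
  Set.ext fun a => φ.realize_congr (Str.Val.set_congr he a)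

theorem Str.mem_solSet {φ : Formula σ} {e : M.Val} {a : Fin n → M.carrier h} :
    a ∈ M.solSet h n φ e ↔ φ.Realize (e.set a) := Iff.rfl

@[simp] theorem Str.solSet_neg (φ : Formula σ) (e : M.Val) :
    M.solSet h n φ.neg e = (M.solSet h n φ e)ᶜ := rfl

@[simp] theorem Str.solSet_and (φ ψ : Formula σ) (e : M.Val) :
    M.solSet h n (φ.and ψ) e = M.solSet h n φ e ∩ M.solSet h n ψ e :=
  Set.ext fun _ => Formula.realize_and _ _ _

/-- Shifting by `N` the variables outside of the context. -/
noncomputable def shift (h : σ.Srt) (n N : ℕ) : σ.Srt → ℕ → ℕ := fun s i =>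
  open Classical in if s = h ∧ i < n then i else i + N

theorem shift_of_mem {h : σ.Srt} {n N i : ℕ} (hi : i < n) : shift h n N h i = i := by
  simp only [shift, hi, and_self, if_true]

theorem shift_of_notMem {h : σ.Srt} {n N : ℕ} {s : σ.Srt} {i : ℕ}
    (hi : ((s, i) : Var σ) ∉ ctx h n) : shift h n N s i = i + N := by
  have : ¬ (s = h ∧ i < n) := hi
  simp only [shift, this, if_false]

theorem shift_injective {h : σ.Srt} {n N : ℕ} (hN : n ≤ N) (s : σ.Srt) :
    (shift h n N s).Injective := by
  intro i j hij
  simp only [shift] at hij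
  split_ifs at hij <;> grind

theorem Str.Val.apply_congr (e : M.Val) {s : σ.Srt} {i j : ℕ} (hij : i = j) :
    (e (s, i) : M.carrier s) = e (s, j) := by rw [hij]

/-- An assignment equal to `c` on the variables of index less than `N`, and to `d` moved by `N`
on the others. -/
def Str.Val.merge (N : ℕ) (c d : M.Val) : M.Val := fun z =>
  if z.2 < N then c z else d (z.1, z.2 - N)

/-- The shifted parameters have index at least `N`, hence are disjoint from the larger context of
`m` variables. The case `m = n` puts two formulas under one assignment; the case `m = n + 1`
describes cylinders. -/
theorem Str.Val.comap_set_merge {m N : ℕ} (hnm : n ≤ m) (hN : m ≤ N) (c d : M.Val)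
    (a : Fin m → M.carrier h) :
    ((Str.Val.merge N c d).set a).comap (shift h n N) = d.set (a ∘ Fin.castLE hnm) := by
  funext z
  refine Str.Val.ctx_cases (P := fun z => ((merge N c d).set a).comap (shift h n N) z =
    d.set (a ∘ Fin.castLE hnm) z) h n (fun i hi => ?_) (fun z hz => ?_) z
  · refine (Str.Val.apply_congr _ (shift_of_mem hi)).trans ?_
    rw [set_apply _ _ hi, set_apply _ _ (hi.trans_le hnm)]
    rfl
  · obtain ⟨s, i⟩ := z
    refine (Str.Val.apply_congr _ (shift_of_notMem hz)).trans ?_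
    rw [set_of_notMem _ _ hz, set_of_notMem]
    · have h1 : ¬ i + N < N := by omega
      simp only [merge, h1, if_false]
      exact Str.Val.apply_congr _ (by simp)
    · rintro ⟨-, h2⟩
      simp only at h2
      omega

/-- The parameters of a shifted formula are those of the formula. -/
theorem Str.Val.merge_mem_params {A : M.Params} {m N : ℕ} {ψ : Formula σ} {c d : M.Val}
    (hd : ∀ z ∈ ψ.fv \ ctx h n, (⟨z.1, d z⟩ : Σ s, M.carrier s) ∈ A) (hnm : n ≤ m)
    (hN : m ≤ N) (z : Var σ) (hz : z ∈ (ψ.rename (shift h n N)).fv) (hzc : z ∉ ctx h m) :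
    (⟨z.1, Str.Val.merge N c d z⟩ : Σ s, M.carrier s) ∈ A := by
  rw [Formula.fv_rename (shift_injective (hnm.trans hN))] at hz
  obtain ⟨⟨s, i⟩, hy, rfl⟩ := hz
  have hy' : ((s, i) : Var σ) ∉ ctx h n := by
    intro hy'
    apply hzc
    have ⟨hs, hi⟩ : s = h ∧ i < n := hy'
    subst hs
    exact ⟨rfl, (shift_of_mem hi).trans_lt (hi.trans_le hnm)⟩
  have h1 : (Str.Val.merge N c d (Var.map (shift h n N) (s, i)) : M.carrier s) = d (s, i) := by
    refine (Str.Val.apply_congr _ (shift_of_notMem hy')).trans ?_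
    have h1 : ¬ i + N < N := by omega
    simp only [Str.Val.merge, h1, if_false]
    exact Str.Val.apply_congr _ (by simp)
  have h2 := hd _ ⟨hy, hy'⟩
  rw [← h1] at h2
  exact h2

theorem Str.solSet_rename_merge {N : ℕ} (hN : n ≤ N) (τ : Formula σ) (c d : M.Val) :
    M.solSet h n (τ.rename (shift h n N)) (Str.Val.merge N c d) = M.solSet h n τ d := by
  ext a
  rw [Str.mem_solSet, Formula.realize_rename (shift_injective hN), Str.Val.comap_set_merge le_rfl hN]
  rfl

/-- A bound for `n` and for the indices of the free variables of `ψ`. -/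
theorem Formula.exists_bound (ψ : Formula σ) (n : ℕ) : ∃ N, n ≤ N ∧ ∀ z ∈ ψ.fv, z.2 < N := by
  obtain ⟨N, hN⟩ := (ψ.finite_fv.image Prod.snd).bddAbove
  refine ⟨max n (N + 1), le_max_left _ _, fun z hz => lt_max_of_lt_right ?_⟩
  exact Nat.lt_succ_of_le (hN ⟨z, hz, rfl⟩)

theorem Str.solSet_merge {N : ℕ} {ψ : Formula σ} (hψ : ∀ z ∈ ψ.fv, z.2 < N) (c d : M.Val) :
    M.solSet h n ψ (Str.Val.merge N c d) = M.solSet h n ψ c :=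
  Str.solSet_congr ψ fun z hz => by simp [Str.Val.merge, hψ z hz.1]

/-! ### Definable sets -/

theorem Str.solSet_mem_def (φ : Formula σ) (e : M.Val) : M.solSet h n φ e ∈ M.Def h n Set.univ :=
  ⟨φ, e, fun _ _ => trivial, rfl⟩

theorem Str.Def_subset_univ {A : M.Params} : M.Def h n A ⊆ M.Def h n Set.univ := by
  rintro D ⟨φ, e, -, h⟩
  exact ⟨φ, e, fun _ _ => trivial, h⟩

theorem Str.Def.compl {A : M.Params} {D : Set (Fin n → M.carrier h)} (hD : D ∈ M.Def h n A) :
    Dᶜ ∈ M.Def h n A := by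
  obtain ⟨φ, e, he, rfl⟩ := hD
  exact ⟨φ.neg, e, by simpa using he, rfl⟩

/-- The two defining formulas may use the same variable for different parameters, so the parameter
variables of the second are first moved beyond those of the first. -/
theorem Str.Def.inter {A : M.Params} {D E : Set (Fin n → M.carrier h)} (hD : D ∈ M.Def h n A)
    (hE : E ∈ M.Def h n A) : D ∩ E ∈ M.Def h n A := by
  obtain ⟨φ, c, hc, rfl⟩ := hD
  obtain ⟨ψ, d, hd, rfl⟩ := hE
  obtain ⟨N, hN, hφ⟩ := φ.exists_bound n
  refine ⟨φ.and (ψ.rename (shift h n N)), Str.Val.merge N c d, ?_, ?_⟩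
  · rintro z ⟨hz, hzc⟩
    rw [Formula.fv_and] at hz
    rcases hz with hz | hz
    · simpa [Str.Val.merge, hφ z hz] using hc z ⟨hz, hzc⟩
    · exact Str.Val.merge_mem_params hd le_rfl hN z hz hzc
  · rw [Str.solSet_and, Str.solSet_rename_merge hN, Str.solSet_merge hφ]

theorem Str.Val.nonempty (M : Str.{u, v, w} σ) : Nonempty M.Val :=
  ⟨fun z => (M.nonempty z.1).some⟩

theorem Str.univ_mem_def (A : M.Params) : Set.univ ∈ M.Def h n A := by
  obtain ⟨e⟩ := Str.Val.nonempty M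
  exact ⟨Formula.falsum.neg, e, by simp [Formula.fv], by ext; simp [Str.solSet, Formula.Realize]⟩

theorem Str.empty_mem_def (A : M.Params) : ∅ ∈ M.Def h n A := by
  simpa using Str.Def.compl (Str.univ_mem_def (M := M) (h := h) (n := n) A)

theorem Str.Def.union {A : M.Params} {D E : Set (Fin n → M.carrier h)} (hD : D ∈ M.Def h n A)
    (hE : E ∈ M.Def h n A) : D ∪ E ∈ M.Def h n A := by
  simpa [Set.compl_inter] using Str.Def.compl (Str.Def.inter (Str.Def.compl hD) (Str.Def.compl hE))

end WideStability

/-! ### Ultrapowers, Łoś's theorem and internal sets -/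

namespace WideStability

variable {σ : Signature.{u, v}}

/-! ### Ultrapowers -/

open Filter in
/-- A representative of a germ. -/
noncomputable def germRep {ι α : Type*} {𝒰 : Ultrafilter ι} (x : Germ (𝒰 : Filter ι) α) : ι → α :=
  Quotient.out (s := germSetoid (𝒰 : Filter ι) α) x

open Filter in
theorem germRep_eq {ι α : Type*} {𝒰 : Ultrafilter ι} (x : Germ (𝒰 : Filter ι) α) :
    (germRep x : Germ (𝒰 : Filter ι) α) = x :=
  Quotient.out_eq (s := germSetoid (𝒰 : Filter ι) α) x

open Filter in
theorem germRep_coe {ι α : Type*} {𝒰 : Ultrafilter ι} (x : ι → α) :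
    germRep (x : Germ (𝒰 : Filter ι) α) =ᶠ[𝒰] x :=
  Germ.coe_eq.1 (germRep_eq _)

/-- The ultrapower `M^ι/𝒰`. -/
noncomputable def Str.ultrapower (M : Str.{u, v, w} σ) {ι : Type w} (𝒰 : Ultrafilter ι) :
    Str.{u, v, w} σ where
  carrier s := Filter.Germ (𝒰 : Filter ι) (M.carrier s)
  nonempty s := ⟨(fun _ => (M.nonempty s).some : ι → M.carrier s)⟩
  fn g xs := (fun i => M.fn g fun k => germRep (xs k) i : ι → _)
  rl R xs := ∀ᶠ i in (𝒰 : Filter ι), M.rl R fun k => germRep (xs k) i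

section

variable {M : Str.{u, v, w} σ} {ι : Type w} (𝒰 : Ultrafilter ι)

/-- The germ of a family of elements. -/
def Str.germ {s : σ.Srt} (x : ι → M.carrier s) : (M.ultrapower 𝒰).carrier s :=
  (x : Filter.Germ (𝒰 : Filter ι) (M.carrier s))

/-- The assignment whose values are the germs of a family of assignments. -/
def Str.Val.germ (e : ι → M.Val) : (M.ultrapower 𝒰).Val := fun z => Str.germ 𝒰 fun i => e i z

theorem Str.exists_germ {s : σ.Srt} (x : (M.ultrapower 𝒰).carrier s) :
    ∃ y : ι → M.carrier s, x = Str.germ 𝒰 y :=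
  ⟨germRep x, (germRep_eq x).symm⟩

theorem Str.germ_eq_iff {s : σ.Srt} {x y : ι → M.carrier s} :
    Str.germ 𝒰 x = Str.germ 𝒰 y ↔ ∀ᶠ i in (𝒰 : Filter ι), x i = y i :=
  Filter.Germ.coe_eq

theorem Str.Val.exists_germ (e : (M.ultrapower 𝒰).Val) :
    ∃ f : ι → M.Val, e = Str.Val.germ 𝒰 f :=
  ⟨fun i z => germRep (e z) i, funext fun z => (germRep_eq (e z)).symm⟩

theorem Term.realize_germ (e : ι → M.Val) {s : σ.Srt} (t : Term σ s) :
    t.realize (Str.Val.germ 𝒰 e) = Str.germ 𝒰 fun i => t.realize (e i) := by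
  induction t with
  | var s i => rfl
  | app g ts ih =>
    simp only [Term.realize, ih]
    refine (Str.germ_eq_iff 𝒰).2 ?_
    have : ∀ᶠ i in (𝒰 : Filter ι), ∀ k,
        germRep (Str.germ 𝒰 fun i => (ts k).realize (e i)) i = (ts k).realize (e i) :=
      Filter.eventually_all.2 fun k => germRep_coe _
    filter_upwards [this] with i hi
    congr 1
    exact funext hi

open Classical in
theorem Str.Val.germ_update (e : ι → M.Val) (z : Var σ) (x : ι → M.carrier z.1) :
    Function.update (Str.Val.germ 𝒰 e) z (Str.germ 𝒰 x) =
      Str.Val.germ 𝒰 fun i => Function.update (e i) z (x i) := by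
  funext y
  by_cases hy : y = z
  · subst hy
    simp [Str.Val.germ]
  · simp [Str.Val.germ, hy]

/-- Łoś's theorem. -/
theorem Formula.realize_germ (φ : Formula σ) (e : ι → M.Val) :
    φ.Realize (Str.Val.germ 𝒰 e) ↔ ∀ᶠ i in (𝒰 : Filter ι), φ.Realize (e i) := by
  induction φ generalizing e with
  | falsum => simpa [Formula.Realize] using 𝒰.neBot.ne
  | eq t t' =>
    simp only [Formula.Realize, Term.realize_germ]
    exact Str.germ_eq_iff 𝒰
  | rel R ts =>
    simp only [Formula.Realize, Term.realize_germ]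
    have : ∀ᶠ i in (𝒰 : Filter ι), ∀ k,
        germRep (Str.germ 𝒰 fun i => (ts k).realize (e i)) i = (ts k).realize (e i) :=
      Filter.eventually_all.2 fun k => germRep_coe _
    refine Filter.eventually_congr (this.mono fun i hi => ?_)
    rw [funext hi]
  | imp φ ψ ih ih' =>
    simp only [Formula.Realize, ih, ih']
    exact Ultrafilter.eventually_imp.symm
  | all s i φ ih =>
    classical
    simp only [Formula.Realize]
    constructor
    · intro H
      by_contra hn
      rw [← Ultrafilter.eventually_not] at hn
      -- A counterexample is chosen in each component that has one; elsewhere any element will do,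
      -- and exists because sorts are nonempty.
      have : ∀ j, ∃ a : M.carrier s, (¬ ∀ a : M.carrier s,
          φ.Realize (Function.update (e j) ((s, i) : Var σ) a)) →
            ¬ φ.Realize (Function.update (e j) ((s, i) : Var σ) a) := by
        intro j
        by_cases hj : ∀ a : M.carrier s, φ.Realize (Function.update (e j) ((s, i) : Var σ) a)
        · exact ⟨(M.nonempty s).some, fun h => absurd hj h⟩
        · obtain ⟨a, ha⟩ := not_forall.1 hj
          exact ⟨a, fun _ => ha⟩
      choose x hx using this
      have h1 := H (Str.germ 𝒰 x)
      rw [Str.Val.germ_update 𝒰 e (s, i) x, ih] at h1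
      obtain ⟨j, hj, hj'⟩ := (h1.and hn).exists
      exact hx j hj' hj
    · intro H a
      obtain ⟨x, rfl⟩ := Str.exists_germ 𝒰 a
      rw [Str.Val.germ_update 𝒰 e (s, i) x, ih]
      exact H.mono fun j hj => hj (x j)

theorem Str.IsModel.ultrapower {T : Theory σ} (hM : M.IsModel T) : (M.ultrapower 𝒰).IsModel T := by
  intro φ hφ e
  obtain ⟨f, rfl⟩ := Str.Val.exists_germ 𝒰 e
  exact (φ.1.realize_germ 𝒰 f).2 (Filter.Eventually.of_forall fun i => hM φ hφ (f i))

/-! ### Internal sets -/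

variable {h : σ.Srt} {n : ℕ}

/-- The tuple of germs of a family of tuples. -/
def Str.germTuple (a : ι → Fin n → M.carrier h) : Fin n → (M.ultrapower 𝒰).carrier h :=
  fun k => Str.germ 𝒰 fun i => a i k

theorem Str.exists_germTuple (x : Fin n → (M.ultrapower 𝒰).carrier h) :
    ∃ a : ι → Fin n → M.carrier h, x = Str.germTuple 𝒰 a :=
  ⟨fun i k => germRep (x k) i, funext fun k => (germRep_eq (x k)).symm⟩

theorem Str.Val.germ_set (e : ι → M.Val) (a : ι → Fin n → M.carrier h) :
    (Str.Val.germ 𝒰 e).set (Str.germTuple 𝒰 a) = Str.Val.germ 𝒰 fun i => (e i).set (a i) := by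
  funext z
  refine Str.Val.ctx_cases (P := fun z => (Str.Val.germ 𝒰 e).set (Str.germTuple 𝒰 a) z =
    Str.Val.germ 𝒰 (fun i => (e i).set (a i)) z) h n (fun i hi => ?_) (fun z hz => ?_) z
  · rw [Str.Val.set_apply _ _ hi]
    simp only [Str.Val.germ, Str.Val.set_apply _ _ hi]
    rfl
  · rw [Str.Val.set_of_notMem _ _ hz]
    simp only [Str.Val.germ, Str.Val.set_of_notMem _ _ hz]

/-- The internal set given by a family of sets of tuples. -/
def Str.star (D : ι → Set (Fin n → M.carrier h)) : Set (Fin n → (M.ultrapower 𝒰).carrier h) :=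
  {x | ∀ᶠ i in (𝒰 : Filter ι), (fun k => germRep (x k) i) ∈ D i}

theorem Str.germTuple_mem_star {D : ι → Set (Fin n → M.carrier h)} {a : ι → Fin n → M.carrier h} :
    Str.germTuple 𝒰 a ∈ Str.star 𝒰 D ↔ ∀ᶠ i in (𝒰 : Filter ι), a i ∈ D i := by
  have : ∀ᶠ i in (𝒰 : Filter ι), ∀ k, germRep (Str.germTuple 𝒰 a k) i = a i k :=
    Filter.eventually_all.2 fun k => germRep_coe _
  refine Filter.eventually_congr (this.mono fun i hi => ?_)
  rw [funext hi]

theorem Str.star_ext {D : ι → Set (Fin n → M.carrier h)}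
    {E : Set (Fin n → (M.ultrapower 𝒰).carrier h)}
    (H : ∀ a : ι → Fin n → M.carrier h,
      (∀ᶠ i in (𝒰 : Filter ι), a i ∈ D i) ↔ Str.germTuple 𝒰 a ∈ E) : Str.star 𝒰 D = E := by
  ext x
  obtain ⟨a, rfl⟩ := Str.exists_germTuple 𝒰 x
  rw [Str.germTuple_mem_star, H]

theorem Str.star_solSet (φ : Formula σ) (e : ι → M.Val) :
    Str.star 𝒰 (fun i => M.solSet h n φ (e i)) =
      (M.ultrapower 𝒰).solSet h n φ (Str.Val.germ 𝒰 e) := by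
  refine Str.star_ext 𝒰 fun a => ?_
  rw [Str.mem_solSet, Str.Val.germ_set, Formula.realize_germ]
  rfl

theorem Str.star_inter (D E : ι → Set (Fin n → M.carrier h)) :
    Str.star 𝒰 (fun i => D i ∩ E i) = Str.star 𝒰 D ∩ Str.star 𝒰 E :=
  Set.ext fun _ => Filter.eventually_and

theorem Str.star_union (D E : ι → Set (Fin n → M.carrier h)) :
    Str.star 𝒰 (fun i => D i ∪ E i) = Str.star 𝒰 D ∪ Str.star 𝒰 E :=
  Set.ext fun _ => Ultrafilter.eventually_or

theorem Str.star_compl (D : ι → Set (Fin n → M.carrier h)) :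
    Str.star 𝒰 (fun i => (D i)ᶜ) = (Str.star 𝒰 D)ᶜ :=
  Set.ext fun _ => Ultrafilter.eventually_not

theorem Str.star_mono {D E : ι → Set (Fin n → M.carrier h)}
    (H : ∀ᶠ i in (𝒰 : Filter ι), D i ⊆ E i) : Str.star 𝒰 D ⊆ Str.star 𝒰 E :=
  fun _ hx => Filter.Eventually.mp hx (H.mono fun _ h1 h2 => h1 h2)

theorem Str.star_empty {D : ι → Set (Fin n → M.carrier h)}
    (H : ∀ᶠ i in (𝒰 : Filter ι), D i = ∅) : Str.star 𝒰 D = ∅ := by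
  refine Set.eq_empty_of_forall_notMem fun x hx => ?_
  obtain ⟨i, hi, hi'⟩ := (H.and (show ∀ᶠ i in (𝒰 : Filter ι), _ from hx)).exists
  simp only [hi] at hi'
  exact hi'

end

end WideStability

/-! ### Fibres, generic fibres and the product schema -/

namespace WideStability

variable {σ : Signature.{u, v}} {M : Str.{u, v, w} σ} {h : σ.Srt} {n : ℕ}

/-! ### Fibres -/

/-- The transposition of the variables `x₀` and `xₙ` of sort `h`. -/
noncomputable def swap (h : σ.Srt) (n : ℕ) : σ.Srt → ℕ → ℕ := fun s =>
  open Classical in if s = h then Equiv.swap 0 n else id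

theorem swap_self (h : σ.Srt) (n : ℕ) : swap h n h = Equiv.swap 0 n := by simp [swap]

theorem swap_of_ne {h s : σ.Srt} (hs : s ≠ h) (n : ℕ) : swap h n s = id := by simp [swap, hs]

theorem swap_injective (h : σ.Srt) (n : ℕ) (s : σ.Srt) : (swap h n s).Injective := by
  by_cases hs : s = h
  · subst hs
    rw [swap_self]
    exact (Equiv.swap 0 n).injective
  · rw [swap_of_ne hs]
    exact Function.injective_id

theorem swap_swap (h : σ.Srt) (n : ℕ) (s : σ.Srt) (i : ℕ) : swap h n s (swap h n s i) = i := by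
  by_cases hs : s = h
  · subst hs
    rw [swap_self]
    exact Equiv.swap_apply_self 0 n i
  · rw [swap_of_ne hs]
    rfl

theorem Var.map_swap_map_swap (h : σ.Srt) (n : ℕ) (z : Var σ) :
    Var.map (swap h n) (Var.map (swap h n) z) = z :=
  Prod.ext rfl (swap_swap h n z.1 z.2)

/-- The fibre at `a` of a set of `n + 1`-tuples. -/
def fibre {α : Type*} {n : ℕ} (D : Set (Fin (n + 1) → α)) (a : Fin n → α) : Set (Fin 1 → α) :=
  {b | Fin.append a b ∈ D}

/-- The fibre variable is `xₙ`, but a schema in one variable speaks about `x₀`. After the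
transposition the fibre variable is `x₀`, and the first entry of `a` (if any) is a parameter at
index `n`, outside the context of one variable. -/
theorem Str.Val.comap_set_swap (e : M.Val) (a : Fin n → M.carrier h) (b : Fin 1 → M.carrier h) :
    (((e.set a).comap (swap h n)).set b).comap (swap h n) = e.set (Fin.append a b) := by
  funext z
  refine Str.Val.ctx_cases (P := fun z => (((e.set a).comap (swap h n)).set b).comap (swap h n) z =
    e.set (Fin.append a b) z) h (n + 1) (fun i hi => ?_) (fun z hz => ?_) z
  · rw [Str.Val.set_apply _ _ hi]
    rcases Nat.lt_succ_iff_lt_or_eq.1 hi with hin | rfl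
    · have h1 : (⟨i, hi⟩ : Fin (n + 1)) = Fin.castAdd 1 ⟨i, hin⟩ := rfl
      rw [h1, Fin.append_left, ← Str.Val.set_apply e a hin]
      have h2 : ((h, swap h n h i) : Var σ) ∉ ctx h 1 := by
        rintro ⟨-, h2⟩
        simp only [swap_self, Nat.lt_one_iff] at h2
        have h3 : i = n := by simpa using congrArg (Equiv.swap 0 n) h2
        omega
      refine (Str.Val.set_of_notMem _ _ h2).trans ?_
      exact Str.Val.apply_congr _ (swap_swap h n h i)
    · have h1 : (⟨i, hi⟩ : Fin (i + 1)) = Fin.natAdd i 0 := rfl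
      rw [h1, Fin.append_right]
      have h2 : swap h i h i = 0 := by simp [swap_self]
      refine (Str.Val.apply_congr (((e.set a).comap (swap h i)).set b) h2).trans ?_
      exact Str.Val.set_apply _ _ Nat.one_pos
  · obtain ⟨s, i⟩ := z
    rw [Str.Val.set_of_notMem _ _ hz]
    have h2 : ((s, swap h n s i) : Var σ) ∉ ctx h 1 := by
      rintro ⟨hs, h2⟩
      simp only at hs
      subst hs
      simp only [swap_self, Nat.lt_one_iff] at h2
      have h3 : i = n := by simpa using congrArg (Equiv.swap 0 n) h2
      exact hz ⟨rfl, by simp [h3]⟩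
    refine (Str.Val.set_of_notMem _ _ h2).trans ?_
    refine (Str.Val.apply_congr _ (swap_swap h n s i)).trans ?_
    exact Str.Val.set_of_notMem _ _ fun h3 => hz ⟨h3.1, Nat.lt_succ_of_lt h3.2⟩

/-- All fibres are instances of one formula, with `a` among the parameters; this uniformity makes
Łoś's theorem applicable to the family of fibres. -/
theorem Str.fibre_solSet (ψ : Formula σ) (e : M.Val) (a : Fin n → M.carrier h) :
    fibre (M.solSet h (n + 1) ψ e) a =
      M.solSet h 1 (ψ.rename (swap h n)) ((e.set a).comap (swap h n)) := by
  ext b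
  rw [Str.mem_solSet, Formula.realize_rename (swap_injective h n), Str.Val.comap_set_swap]
  rfl

/-! ### Ideal schemas -/

theorem VPreschema.Invariant.solSet_mem_points {I : VPreschema σ h n} (hI : I.Invariant M)
    {ψ : Formula σ} {e : M.Val} : M.solSet h n ψ e ∈ I.points M ↔ ¬ I.Wide ψ e := by
  constructor
  · rintro ⟨θ, d, hθ, hd⟩
    rwa [hI ψ θ e d hθ]
  · exact fun H => ⟨ψ, e, rfl, H⟩

/-- A uniformly definable family of sets that are almost all outside of the ideal yields an
internal set outside of the ideal. -/
theorem VPreschema.IsIdealSchema.star_mem_points {T : Theory σ} {I : VPreschema σ h n}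
    (hI : VPreschema.IsIdealSchema.{u, v, w} I T) (hM : M.IsModel T) {ι : Type w}
    (𝒰 : Ultrafilter ι) (ψ : Formula σ) (e : ι → M.Val) :
    Str.star 𝒰 (fun i => M.solSet h n ψ (e i)) ∉ I.points (M.ultrapower 𝒰) ↔
      ∀ θ ∈ I.notI ψ, ∀ᶠ i in (𝒰 : Filter ι), θ.Realize (e i) := by
  rw [Str.star_solSet, (hI _ (hM.ultrapower 𝒰)).1.solSet_mem_points, not_not]
  exact forall₂_congr fun θ _ => θ.realize_germ 𝒰 e

/-! ### The product schema -/

/-- The formulas expressing that the fibre of `ψ` at `x₀, …, xₙ₋₁` is not in `I`. -/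
def VPreschema.fibreWide (I : VPreschema σ h 1) (n : ℕ) (ψ : Formula σ) : Set (Formula σ) :=
  Formula.rename (swap h n) '' I.notI (ψ.rename (swap h n))

theorem VPreschema.fv_fibreWide (I : VPreschema σ h 1) {ψ θ : Formula σ}
    (hθ : θ ∈ I.fibreWide n ψ) : θ.fv ⊆ ψ.fv \ {(h, n)} := by
  obtain ⟨χ, hχ, rfl⟩ := hθ
  have h1 := I.fv_subset _ χ hχ
  rw [Formula.fv_rename (swap_injective h n)] at h1 ⊢
  rintro _ ⟨z, hz, rfl⟩
  obtain ⟨⟨y, hy, rfl⟩, h3⟩ := h1 hz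
  rw [Var.map_swap_map_swap]
  refine ⟨hy, ?_⟩
  rintro rfl
  exact h3 ⟨rfl, by simp [Var.map, swap_self]⟩

theorem VPreschema.realize_fibreWide (I : VPreschema σ h 1) (ψ : Formula σ) (e : M.Val) :
    (∀ θ ∈ I.fibreWide n ψ, θ.Realize e) ↔
      I.Wide (ψ.rename (swap h n)) (e.comap (swap h n)) := by
  simp only [fibreWide, Set.forall_mem_image, Formula.realize_rename (swap_injective h n)]
  rfl

/-- The schema of `J ⊗ I`. -/
def VPreschema.prod (J : VPreschema σ h n) (I : VPreschema σ h 1) : VPreschema σ h (n + 1) where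
  -- Wideness of the fibre is expressed by a set of formulas rather than by one, so the product is
  -- declared wide when every finite part of that set defines a `J`-wide set.
  notI ψ := {χ | ∃ l : List (Formula σ), (∀ θ ∈ l, θ ∈ I.fibreWide n ψ) ∧
    χ ∈ J.notI (Formula.conj l)}
  fv_subset := by
    rintro ψ χ ⟨l, hl, hχ⟩ z hz
    obtain ⟨h1, h2⟩ := J.fv_subset _ χ hχ hz
    have h3 := Formula.fv_conj_subset (fun θ hθ => I.fv_fibreWide (hl θ hθ)) h1
    refine ⟨h3.1, fun h4 => ?_⟩
    obtain ⟨s, i⟩ := z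
    have ⟨hs, hi⟩ : s = h ∧ i < n + 1 := h4
    subst hs
    rcases Nat.lt_succ_iff_lt_or_eq.1 hi with hin | rfl
    · exact h2 ⟨rfl, hin⟩
    · exact h3.2 rfl

theorem VPreschema.wide_prod (J : VPreschema σ h n) (I : VPreschema σ h 1) (ψ : Formula σ)
    (e : M.Val) : (J.prod I).Wide ψ e ↔
      ∀ l : List (Formula σ), (∀ θ ∈ l, θ ∈ I.fibreWide n ψ) → J.Wide (Formula.conj l) e := by
  constructor
  · exact fun H l hl χ hχ => H χ ⟨l, hl, hχ⟩
  · rintro H χ ⟨l, hl, hχ⟩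
    exact H l hl χ hχ

/-- The internal fibre of `D` at the generic point of an ultrafilter on the set of `n`-tuples. -/
def Str.genericFibre (𝒰 : Ultrafilter (Fin n → M.carrier h))
    (D : Set (Fin (n + 1) → M.carrier h)) : Set (Fin 1 → (M.ultrapower 𝒰).carrier h) :=
  Str.star 𝒰 fun a => fibre D a

variable {T : Theory σ} {I : VPreschema σ h 1} {J : VPreschema σ h n}

/-- Łoś's theorem, applied to the formulas expressing wideness of the fibre one at a time. -/
theorem VPreschema.IsIdealSchema.genericFibre_mem
    (hI : VPreschema.IsIdealSchema.{u, v, w} I T) (hM : M.IsModel T)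
    (𝒰 : Ultrafilter (Fin n → M.carrier h)) (ψ : Formula σ) (e : M.Val) :
    Str.genericFibre 𝒰 (M.solSet h (n + 1) ψ e) ∉ I.points (M.ultrapower 𝒰) ↔
      ∀ θ ∈ I.fibreWide n ψ, M.solSet h n θ e ∈ 𝒰 := by
  simp only [Str.genericFibre, Str.fibre_solSet]
  rw [hI.star_mem_points hM]
  simp only [fibreWide, Set.forall_mem_image]
  refine forall₂_congr fun θ _ => ?_
  refine Filter.eventually_congr (Filter.Eventually.of_forall fun a => ?_)
  exact (Formula.realize_rename (swap_injective h n) θ _).symm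

/-- The semantic description of the ideal of the product schema. -/
def Str.prodIdeal (M : Str.{u, v, w} σ) (J : Set (Set (Fin n → M.carrier h)))
    (I : VPreschema σ h 1) : Set (Set (Fin (n + 1) → M.carrier h)) :=
  {D | D ∈ M.Def h (n + 1) Set.univ ∧ ∃ F ∈ J, ∀ 𝒰 : Ultrafilter (Fin n → M.carrier h),
    Str.genericFibre 𝒰 D ∉ I.points (M.ultrapower 𝒰) → F ∈ 𝒰}

/-- Compactness for families of sets. -/
theorem exists_list_of_forall_ultrafilter {α β : Type*} (S : Set β) (s : β → Set α) (F : Set α)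
    (H : ∀ 𝒰 : Ultrafilter α, (∀ b ∈ S, s b ∈ 𝒰) → F ∈ 𝒰) :
    ∃ l : List β, (∀ b ∈ l, b ∈ S) ∧ {a | ∀ b ∈ l, a ∈ s b} ⊆ F := by
  by_contra! hn
  -- If no finite intersection lies in `F`, the finite intersections minus `F` generate a proper
  -- filter. An ultrafilter refining it contains every `s b` and also the complement of `F`.
  let g : {l : List β // ∀ b ∈ l, b ∈ S} → Filter α := fun l =>
    Filter.principal ({a | ∀ b ∈ l.1, a ∈ s b} \ F)
  have hdir : Directed (· ≥ ·) g := by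
    intro l l'
    refine ⟨⟨l.1 ++ l'.1, fun b hb => (List.mem_append.1 hb).elim (l.2 b) (l'.2 b)⟩, ?_, ?_⟩
    · exact Filter.principal_mono.2 fun a ha =>
        ⟨fun b hb => ha.1 b (List.mem_append_left _ hb), ha.2⟩
    · exact Filter.principal_mono.2 fun a ha =>
        ⟨fun b hb => ha.1 b (List.mem_append_right _ hb), ha.2⟩
  have : Nonempty {l : List β // ∀ b ∈ l, b ∈ S} := ⟨⟨[], by simp⟩⟩
  have : (⨅ l, g l).NeBot := Filter.iInf_neBot_of_directed' hdir fun l =>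
    Filter.principal_neBot_iff.2 (Set.sdiff_nonempty.2 (hn l.1 l.2))
  have hU := Ultrafilter.of_le (⨅ l, g l)
  have hF : F ∈ Ultrafilter.of (⨅ l, g l) := H _ fun b hb => by
    refine Filter.mem_of_superset (hU ((iInf_le g ⟨[b], by simpa using hb⟩)
      (Filter.mem_principal_self _))) ?_
    exact fun a ha => ha.1 b (by simp)
  have hF' : Fᶜ ∈ Ultrafilter.of (⨅ l, g l) := by
    refine Filter.mem_of_superset (hU ((iInf_le g ⟨[], by simp⟩)
      (Filter.mem_principal_self _))) ?_
    exact fun a ha => ha.2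
  exact Ultrafilter.compl_notMem_iff.2 hF hF'

/-- A finite conjunction defining a set in `J` serves as `F`. Conversely, compactness shows that a
given `F` contains the set defined by some finite conjunction. The right side depends only on the
set and not on the formula, whence the invariance of the product schema; no saturation is needed. -/
theorem VPreschema.IsIdealSchema.not_wide_prod_iff
    (hI : VPreschema.IsIdealSchema.{u, v, w} I T) (hJ : VPreschema.IsIdealSchema.{u, v, w} J T)
    (hM : M.IsModel T) (ψ : Formula σ) (e : M.Val) :
    ¬ (J.prod I).Wide ψ e ↔ M.solSet h (n + 1) ψ e ∈ M.prodIdeal (J.points M) I := by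
  have key : ∀ l, M.solSet h n (Formula.conj l) e = {a | ∀ θ ∈ l, a ∈ M.solSet h n θ e} :=
    fun l => Set.ext fun a => Formula.realize_conj l _
  simp only [VPreschema.wide_prod, not_forall, Str.prodIdeal, Set.mem_ofPred_eq,
    Str.solSet_mem_def, true_and, hI.genericFibre_mem hM, exists_prop,
    ← (hJ M hM).1.solSet_mem_points]
  constructor
  · rintro ⟨l, hl, hF⟩
    refine ⟨_, hF, fun 𝒰 H => ?_⟩
    rw [key]
    have : ∀ᶠ a in (𝒰 : Filter _), ∀ θ ∈ l, a ∈ M.solSet h n θ e := by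
      exact (Filter.eventually_all_finite (List.finite_toSet l)).2 fun θ hθ => H θ (hl θ hθ)
    exact this
  · rintro ⟨F, hF, H⟩
    obtain ⟨l, hl, hlF⟩ := exists_list_of_forall_ultrafilter _ (fun θ => M.solSet h n θ e) F H
    refine ⟨l, hl, (hJ M hM).2.mem_of_subset F hF _ (Str.solSet_mem_def _ e) ?_⟩
    rwa [key]

end WideStability

/-! ### The product is an ideal schema; saturated models and completeness -/

namespace WideStability

variable {σ : Signature.{u, v}} {M : Str.{u, v, w} σ} {h : σ.Srt} {n : ℕ}
variable {T : Theory σ} {I : VPreschema σ h 1} {J : VPreschema σ h n}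

theorem Str.genericFibre_mono (𝒰 : Ultrafilter (Fin n → M.carrier h))
    {D E : Set (Fin (n + 1) → M.carrier h)} (hDE : D ⊆ E) :
    Str.genericFibre 𝒰 D ⊆ Str.genericFibre 𝒰 E :=
  Str.star_mono 𝒰 (Filter.Eventually.of_forall fun _ _ hb => hDE hb)

theorem Str.genericFibre_inter (𝒰 : Ultrafilter (Fin n → M.carrier h))
    (D E : Set (Fin (n + 1) → M.carrier h)) :
    Str.genericFibre 𝒰 (D ∩ E) = Str.genericFibre 𝒰 D ∩ Str.genericFibre 𝒰 E :=
  Str.star_inter 𝒰 _ _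

theorem Str.genericFibre_union (𝒰 : Ultrafilter (Fin n → M.carrier h))
    (D E : Set (Fin (n + 1) → M.carrier h)) :
    Str.genericFibre 𝒰 (D ∪ E) = Str.genericFibre 𝒰 D ∪ Str.genericFibre 𝒰 E :=
  Str.star_union 𝒰 _ _

theorem Str.genericFibre_compl (𝒰 : Ultrafilter (Fin n → M.carrier h))
    (D : Set (Fin (n + 1) → M.carrier h)) :
    Str.genericFibre 𝒰 Dᶜ = (Str.genericFibre 𝒰 D)ᶜ :=
  Str.star_compl 𝒰 _

theorem Str.genericFibre_solSet (𝒰 : Ultrafilter (Fin n → M.carrier h)) (ψ : Formula σ)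
    (e : M.Val) : Str.genericFibre 𝒰 (M.solSet h (n + 1) ψ e) =
      (M.ultrapower 𝒰).solSet h 1 (ψ.rename (swap h n))
        (Str.Val.germ 𝒰 fun a => (e.set a).comap (swap h n)) := by
  simp only [Str.genericFibre, Str.fibre_solSet]
  exact Str.star_solSet 𝒰 _ _

theorem Str.genericFibre_mem_def (𝒰 : Ultrafilter (Fin n → M.carrier h))
    {D : Set (Fin (n + 1) → M.carrier h)} (hD : D ∈ M.Def h (n + 1) Set.univ) :
    Str.genericFibre 𝒰 D ∈ (M.ultrapower 𝒰).Def h 1 Set.univ := by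
  obtain ⟨ψ, e, -, rfl⟩ := hD
  rw [Str.genericFibre_solSet]
  exact Str.solSet_mem_def _ _

theorem VPreschema.IsIdealSchema.points_prod
    (hI : VPreschema.IsIdealSchema.{u, v, w} I T) (hJ : VPreschema.IsIdealSchema.{u, v, w} J T)
    (hM : M.IsModel T) : (J.prod I).points M = M.prodIdeal (J.points M) I := by
  ext D
  constructor
  · rintro ⟨ψ, c, rfl, hc⟩
    exact (hI.not_wide_prod_iff hJ hM ψ c).1 hc
  · intro hD
    obtain ⟨ψ, c, -, rfl⟩ := hD.1
    exact ⟨ψ, c, rfl, (hI.not_wide_prod_iff hJ hM ψ c).2 hD⟩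

/-- Passing to the generic fibre commutes with unions and preserves inclusions, so the ideal axioms
for the product come from those for `I` in each ultrapower and for `J` in `M`. -/
theorem VPreschema.IsIdealSchema.prod
    (hI : VPreschema.IsIdealSchema.{u, v, w} I T) (hJ : VPreschema.IsIdealSchema.{u, v, w} J T) :
    VPreschema.IsIdealSchema.{u, v, w} (J.prod I) T := by
  intro M hM
  refine ⟨fun ψ θ c d hcd => ?_, ?_⟩
  · rw [← not_iff_not, hI.not_wide_prod_iff hJ hM, hI.not_wide_prod_iff hJ hM, hcd]
  · rw [hI.points_prod hJ hM]
    have hJM := (hJ M hM).2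
    have hIN := fun 𝒰 : Ultrafilter (Fin n → M.carrier h) => (hI _ (hM.ultrapower 𝒰)).2
    refine ⟨fun D hD => hD.1, ⟨Str.empty_mem_def _, ∅, hJM.empty_mem, fun 𝒰 H => ?_⟩, ?_, ?_⟩
    · refine absurd ?_ H
      rw [Str.genericFibre, Str.star_empty 𝒰 (D := fun a => fibre ∅ a)
        (Filter.Eventually.of_forall fun a => rfl)]
      exact (hIN 𝒰).empty_mem
    · rintro D ⟨hD, F, hF, H⟩ E hE hED
      refine ⟨hE, F, hF, fun 𝒰 hEI => H 𝒰 fun hDI => hEI ?_⟩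
      exact (hIN 𝒰).mem_of_subset _ hDI _ (Str.genericFibre_mem_def 𝒰 hE)
        (Str.genericFibre_mono 𝒰 hED)
    · rintro D ⟨hD, F, hF, H⟩ E ⟨hE, F', hF', H'⟩
      refine ⟨Str.Def.union hD hE, F ∪ F', hJM.union_mem _ hF _ hF', fun 𝒰 hDE => ?_⟩
      by_cases h1 : Str.genericFibre 𝒰 D ∈ I.points (M.ultrapower 𝒰)
      · by_cases h2 : Str.genericFibre 𝒰 E ∈ I.points (M.ultrapower 𝒰)
        · rw [Str.genericFibre_union] at hDE
          exact absurd ((hIN 𝒰).union_mem _ h1 _ h2) hDE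
        · exact Filter.mem_of_superset (H' 𝒰 h2) Set.subset_union_right
      · exact Filter.mem_of_superset (H 𝒰 h1) Set.subset_union_left

/-! ### Saturated models -/

theorem Str.Val.eq_set_of_forall {e e' : M.Val} (he : ∀ z, z ∉ ctx h n → e' z = e z) :
    e' = e.set (fun i : Fin n => e' (h, i)) := by
  funext z
  refine Str.Val.ctx_cases (P := fun z => e' z = e.set (fun i : Fin n => e' (h, i)) z) h n
    (fun i hi => ?_) (fun z hz => ?_) z
  · rw [Str.Val.set_apply _ _ hi]
  · rw [Str.Val.set_of_notMem _ _ hz, he z hz]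

theorem VPreschema.IsIdealSchema.fibre_mem
    (hI : VPreschema.IsIdealSchema.{u, v, w} I T) (hM : M.IsModel T) (ψ : Formula σ) (e : M.Val)
    (a : Fin n → M.carrier h) : fibre (M.solSet h (n + 1) ψ e) a ∉ I.points M ↔
      ∀ θ ∈ I.fibreWide n ψ, θ.Realize (e.set a) := by
  rw [Str.fibre_solSet, (hI M hM).1.solSet_mem_points, not_not, VPreschema.realize_fibreWide]

theorem exists_ctx_finset (h : σ.Srt) (n : ℕ) :
    ∃ X : Finset (Var σ), ∀ z, z ∈ X ↔ z ∈ ctx h n := by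
  classical
  refine ⟨(Finset.range n).image fun i => (h, i), ?_⟩
  rintro ⟨s, i⟩
  simp only [Finset.mem_image, Finset.mem_range, Prod.mk.injEq]
  constructor
  · rintro ⟨j, hj, rfl, rfl⟩
    exact ⟨rfl, hj⟩
  · rintro ⟨h1, hi⟩
    exact ⟨i, hi, h1.symm, rfl⟩

/-- In a saturated model, a definable set that contains a type-definable set contains a finite
part of it. -/
theorem Str.IsOmegaSaturated.exists_list (hM : M.IsOmegaSaturated) {S : Set (Formula σ)}
    {V : Set (Var σ)} (hV : V.Finite) (hS : ∀ θ ∈ S, θ.fv ⊆ V) (e : M.Val)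
    {F : Set (Fin n → M.carrier h)} (hF : F ∈ M.Def h n Set.univ)
    (hSF : {a | ∀ θ ∈ S, θ.Realize (e.set a)} ⊆ F) :
    ∃ l : List (Formula σ), (∀ θ ∈ l, θ ∈ S) ∧ M.solSet h n (Formula.conj l) e ⊆ F := by
  classical
  by_contra! hn
  obtain ⟨τ, d, -, rfl⟩ := hF
  obtain ⟨N', hN'⟩ := (hV.image Prod.snd).bddAbove
  obtain ⟨N, hN, hSN⟩ : ∃ N, n ≤ N ∧ ∀ z ∈ V, z.2 < N :=
    ⟨max n (N' + 1), le_max_left _ _, fun z hz =>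
      lt_max_of_lt_right (Nat.lt_succ_of_le (hN' ⟨z, hz, rfl⟩))⟩
  obtain ⟨X, hX⟩ := exists_ctx_finset h n
  -- The formula defining `F` has its own parameters; shifting them lets one assignment serve for
  -- both `S` and `F`.
  set τ' := τ.rename (shift h n N) with hτ'
  have hmerge : ∀ θ ∈ S, ∀ a : Fin n → M.carrier h,
      θ.Realize ((Str.Val.merge N e d).set a) ↔ θ.Realize (e.set a) := fun θ hθ a => by
    have := Str.solSet_merge (h := h) (n := n) (fun z hz => hSN z (hS θ hθ hz)) e d
    exact Set.ext_iff.1 this a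
  have hmerge' : ∀ a : Fin n → M.carrier h,
      τ'.Realize ((Str.Val.merge N e d).set a) ↔ a ∈ M.solSet h n τ d := fun a => by
    rw [← Str.solSet_rename_merge hN τ e d]
    rfl
  -- Saturation is applied to `S` together with the negation of `F`: finitely satisfiable by
  -- assumption, yet not realizable.
  obtain ⟨e', he', he''⟩ := hM X (hV.union τ'.finite_fv).toFinset (insert τ'.neg S)
    (Str.Val.merge N e d) (by
      simp only [Set.Finite.coe_toFinset, Set.mem_insert_iff, forall_eq_or_imp, Formula.fv_neg]
      exact ⟨Set.subset_union_right, fun θ hθ => (hS θ hθ).trans Set.subset_union_left⟩)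
    (by
      intro q hq
      obtain ⟨a, ha, haF⟩ := Set.not_subset.1
        (hn (q.filter (· ∈ S)).toList fun θ hθ => by simp at hθ; exact hθ.2)
      refine ⟨(Str.Val.merge N e d).set a, fun z hz => ?_, fun φ hφ => ?_⟩
      · exact Str.Val.set_of_notMem _ _ (by rwa [hX] at hz)
      · rcases hq hφ with rfl | hφS
        · exact fun h1 => haF ((hmerge' a).1 h1)
        · rw [hmerge φ hφS]
          rw [Str.mem_solSet, Formula.realize_conj] at ha
          exact ha φ (by simp [hφ, hφS]))
  have h1 := Str.Val.eq_set_of_forall fun z hz => he' z (by rwa [hX])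
  rw [h1] at he''
  refine he'' _ (Set.mem_insert _ _) ?_
  rw [hmerge']
  exact hSF fun θ hθ => (hmerge θ hθ _).1 (he'' θ (Set.mem_insert_of_mem _ hθ))

/-- The Fubini product only tests fibres over actual tuples of the model. If `F` contains all tuples
with wide fibre, saturation yields a finite part of the wideness conditions that already forces
membership in `F`. -/
theorem VPreschema.IsIdealSchema.points_prod_of_isOmegaSaturated
    (hI : VPreschema.IsIdealSchema.{u, v, w} I T) (hJ : VPreschema.IsIdealSchema.{u, v, w} J T)
    (hM : M.IsModel T) (hMs : M.IsOmegaSaturated) :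
    (J.prod I).points M = M.fubini h (J.points M) (I.points M) := by
  ext D
  constructor
  · rintro ⟨ψ, e, rfl, hw⟩
    simp only [VPreschema.wide_prod, not_forall, exists_prop,
      ← (hJ M hM).1.solSet_mem_points] at hw
    obtain ⟨l, hl, hF⟩ := hw
    refine ⟨Str.solSet_mem_def _ _, _, hF, fun a ha => ?_⟩
    have h1 := (hI.fibre_mem hM ψ e a).1 ha
    exact (Formula.realize_conj l _).2 fun θ hθ => h1 θ (hl θ hθ)
  · rintro ⟨⟨ψ, e, -, rfl⟩, F, hF, hsub⟩
    refine ⟨ψ, e, rfl, ?_⟩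
    simp only [VPreschema.wide_prod, not_forall, exists_prop,
      ← (hJ M hM).1.solSet_mem_points]
    obtain ⟨l, hl, hlF⟩ := hMs.exists_list ψ.finite_fv
      (fun θ hθ => (I.fv_fibreWide hθ).trans Set.sdiff_subset) e ((hJ M hM).2.subset_def hF)
      (fun a ha => hsub ((hI.fibre_mem hM ψ e a).2 ha))
    exact ⟨l, hl, (hJ M hM).2.mem_of_subset F hF _ (Str.solSet_mem_def _ e) hlF⟩

/-- The powers of a schema. -/
def VPreschema.pow (I : VPreschema σ h 1) : (n : ℕ) → VPreschema σ h (n + 1)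
  | 0 => I
  | n + 1 => (I.pow n).prod I

theorem VPreschema.IsIdealSchema.pow (hI : VPreschema.IsIdealSchema.{u, v, w} I T) (n : ℕ) :
    VPreschema.IsIdealSchema.{u, v, w} (I.pow n) T := by
  induction n with
  | zero => exact hI
  | succ n ih => exact hI.prod ih

theorem VPreschema.IsIdealSchema.points_pow (hI : VPreschema.IsIdealSchema.{u, v, w} I T)
    (hM : M.IsModel T) (hMs : M.IsOmegaSaturated) (n : ℕ) :
    (I.pow n).points M = M.fubiniPow h (I.points M) n := by
  induction n with
  | zero => rfl
  | succ n ih =>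
    rw [Str.fubiniPow, ← ih]
    exact hI.points_prod_of_isOmegaSaturated (hI.pow n) hM hMs

/-- A saturated model realizes the type of every finite tuple of a model. -/
theorem Str.IsOmegaSaturated.exists_val {U : Str.{u, v, w} σ} (hU : U.IsOmegaSaturated)
    (hT : ∀ φ : Sentence σ, φ ∈ T ∨ φ.neg ∈ T) (hUT : U.IsModel T) (hM : M.IsModel T) (e : M.Val)
    {V : Set (Var σ)} (hV : V.Finite) :
    ∃ e' : U.Val, ∀ φ : Formula σ, φ.fv ⊆ V → (φ.Realize e ↔ φ.Realize e') := by
  obtain ⟨e₀⟩ := Str.Val.nonempty U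
  obtain ⟨e', -, he'⟩ := hU hV.toFinset hV.toFinset {φ | φ.fv ⊆ V ∧ φ.Realize e} e₀
    (fun φ hφ => by simpa using hφ.1)
    (by
      intro q hq
      let χ : Sentence σ := ⟨Formula.exs hV.toFinset.toList (Formula.conj q.toList), by
        rw [Formula.fv_exs, Set.sdiff_eq_empty]
        refine Formula.fv_conj_subset fun φ hφ => ?_
        have := (hq (by simpa using hφ)).1
        simpa using this⟩
      have h1 : χ.1.Realize e := by
        rw [Formula.realize_exs]
        refine ⟨e, fun _ _ => rfl, ?_⟩
        rw [Formula.realize_conj]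
        exact fun φ hφ => (hq (by simpa using hφ)).2
      have h2 : χ ∈ T := (hT χ).resolve_right fun h2 => hM _ h2 e h1
      obtain ⟨e', he', h3⟩ := (Formula.realize_exs _ _ _).1 (hUT _ h2 e₀)
      rw [Formula.realize_conj] at h3
      exact ⟨e', fun z hz => he' z (by simpa using hz), fun φ hφ => h3 φ (by simpa using hφ)⟩)
  refine ⟨e', fun φ hφ => ⟨fun h1 => he' φ ⟨hφ, h1⟩, fun h1 => ?_⟩⟩
  by_contra h2
  exact he' φ.neg ⟨by simpa using hφ, h2⟩ h1

/-- Ideal schemas with the same points in a saturated model have the same points in all models. -/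
theorem VPreschema.IsIdealSchema.points_eq {P Q : VPreschema σ h n} {U : Str.{u, v, w} σ}
    (hP : VPreschema.IsIdealSchema.{u, v, w} P T) (hQ : VPreschema.IsIdealSchema.{u, v, w} Q T)
    (hT : ∀ φ : Sentence σ, φ ∈ T ∨ φ.neg ∈ T) (hU : U.IsOmegaSaturated) (hUT : U.IsModel T)
    (hPQ : P.points U = Q.points U) (hM : M.IsModel T) : P.points M = Q.points M := by
  -- Wideness of an instance depends only on the type of its parameters, and this type is realized
  -- in `U`.
  have key : ∀ (ψ : Formula σ) (c : M.Val), P.Wide ψ c ↔ Q.Wide ψ c := by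
    intro ψ c
    obtain ⟨d, hd⟩ := hU.exists_val hT hUT hM c ψ.finite_fv
    have h1 : ∀ R : VPreschema σ h n, R.Wide ψ c ↔ R.Wide ψ d := fun R =>
      forall₂_congr fun θ hθ => hd θ ((R.fv_subset ψ θ hθ).trans Set.sdiff_subset)
    rw [h1 P, h1 Q, ← not_iff_not, ← (hP U hUT).1.solSet_mem_points,
      ← (hQ U hUT).1.solSet_mem_points, hPQ]
  simp only [VPreschema.points, key]

end WideStability

/-! ### Wide types, their restrictions and their extensions -/

namespace WideStability

variable {σ : Signature.{u, v}} {M : Str.{u, v, w} σ} {h : σ.Srt} {n : ℕ}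
variable {T : Theory σ} {I : VPreschema σ h 1} {J : VPreschema σ h n}

/-! ### Wide types -/

/-- A family of definable sets whose finite intersections are outside of an ideal extends to a
wide type. -/
theorem Str.IsIdeal.exists_wideType {K : Set (Set (Fin n → M.carrier h))} (hK : M.IsIdeal h n K)
    {A : M.Params} {α : Type*} (s : α → Set (Fin n → M.carrier h)) (hs : ∀ i, s i ∈ M.Def h n A)
    (H : ∀ t : List α, ∀ E ∈ K, ¬ {a | ∀ i ∈ t, a ∈ s i} ⊆ E) :
    ∃ p ∈ M.wideTypes h n K A, ∀ i, s i ∈ p := by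
  obtain ⟨𝒰, h𝒰⟩ : ∃ 𝒰 : Ultrafilter (Fin n → M.carrier h),
      ∀ b : α ⊕ K, Sum.elim s (fun E => E.1ᶜ) b ∈ 𝒰 := by
    by_contra hn
    obtain ⟨l, -, hl⟩ := exists_list_of_forall_ultrafilter Set.univ
      (Sum.elim s (fun E : K => E.1ᶜ)) ∅ fun 𝒰 h𝒰 => absurd ⟨𝒰, fun b => h𝒰 b trivial⟩ hn
    -- The finitely many sets of the ideal that occur are absorbed into a single one by taking their
    -- union.
    have : ∀ l : List (α ⊕ K), ∃ t : List α, ∃ E ∈ K, ∀ a, (∀ i ∈ t, a ∈ s i) → a ∉ E →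
        ∀ b ∈ l, a ∈ Sum.elim s (fun E : K => E.1ᶜ) b := by
      intro l
      induction l with
      | nil => exact ⟨[], ∅, hK.empty_mem, by simp⟩
      | cons b l ih =>
        obtain ⟨t, E, hE, ht⟩ := ih
        rcases b with i | F
        · refine ⟨i :: t, E, hE, fun a ha haE => ?_⟩
          simp only [List.mem_cons, forall_eq_or_imp] at ha ⊢
          exact ⟨ha.1, ht a ha.2 haE⟩
        · refine ⟨t, E ∪ F, hK.union_mem E hE F F.2, fun a ha haE => ?_⟩
          simp only [List.mem_cons, forall_eq_or_imp]
          exact ⟨fun haF => haE (Or.inr haF), ht a ha fun haE' => haE (Or.inl haE')⟩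
    obtain ⟨t, E, hE, ht⟩ := this l
    refine H t E hE fun a ha => ?_
    by_contra haE
    exact hl (ht a ha haE)
  refine ⟨{D | D ∈ M.Def h n A ∧ D ∈ 𝒰}, ⟨⟨fun D hD => hD.1, fun h0 => 𝒰.empty_notMem h0.2,
    fun D hD E hE => ⟨Str.Def.inter hD.1 hE.1, Filter.inter_mem hD.2 hE.2⟩,
    fun D hD E hE hDE => ⟨hE, Filter.mem_of_superset hD.2 hDE⟩, fun D hD => ?_⟩, ?_⟩,
    fun i => ⟨hs i, h𝒰 (Sum.inl i)⟩⟩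
  · rcases 𝒰.mem_or_compl_mem D with h1 | h1
    · exact Or.inl ⟨hD, h1⟩
    · exact Or.inr ⟨Str.Def.compl hD, h1⟩
  · rw [Set.disjoint_left]
    exact fun D hD hDK => Ultrafilter.compl_notMem_iff.2 hD.2 (h𝒰 (Sum.inr ⟨D, hDK⟩))

theorem Str.IsCompleteType.univ_mem {A : M.Params} {p : Set (Set (Fin n → M.carrier h))}
    (hp : M.IsCompleteType h n A p) : Set.univ ∈ p := by
  rcases hp.mem_or_compl_mem _ (Str.univ_mem_def A) with h1 | h1
  · exact h1
  · rw [Set.compl_univ] at h1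
    exact absurd h1 hp.empty_notMem

theorem Str.IsCompleteType.compl_notMem {A : M.Params} {p : Set (Set (Fin n → M.carrier h))}
    (hp : M.IsCompleteType h n A p) {D : Set (Fin n → M.carrier h)} (hD : D ∈ p) : Dᶜ ∉ p := by
  intro h1
  have h2 := hp.inter_mem _ hD _ h1
  rw [Set.inter_compl_self] at h2
  exact hp.empty_notMem h2

/-- The ultrafilter lives on the full power set, so that it defines an ultrapower, in which its
generic tuple realizes the type. -/
theorem Str.IsCompleteType.exists_ultrafilter {A : M.Params}
    {p : Set (Set (Fin n → M.carrier h))} (hp : M.IsCompleteType h n A p) :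
    ∃ 𝒰 : Ultrafilter (Fin n → M.carrier h), ∀ D ∈ p, D ∈ 𝒰 := by
  by_contra hn
  obtain ⟨l, hl, hl'⟩ := exists_list_of_forall_ultrafilter p id ∅
    fun 𝒰 h𝒰 => absurd ⟨𝒰, h𝒰⟩ hn
  have : ∀ l : List (Set (Fin n → M.carrier h)), (∀ b ∈ l, b ∈ p) →
      {a | ∀ b ∈ l, a ∈ id b} ∈ p := by
    intro l
    induction l with
    | nil => intro _; simpa using hp.univ_mem
    | cons b l ih =>
      intro hbl
      simp only [List.mem_cons, forall_eq_or_imp] at hbl ⊢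
      exact hp.inter_mem _ hbl.1 _ (ih hbl.2)
  have h1 := this l hl
  rw [Set.subset_empty_iff.1 hl'] at h1
  exact hp.empty_notMem h1

/-- Distinct complete types are separated by a definable set. -/
theorem Str.IsCompleteType.eq_of_forall {A : M.Params} {p q : Set (Set (Fin n → M.carrier h))}
    (hp : M.IsCompleteType h n A p) (hq : M.IsCompleteType h n A q)
    (H : ∀ D ∈ p, Dᶜ ∉ q) : p = q := by
  have h1 : p ⊆ q := fun D hD => (hq.mem_or_compl_mem D (hp.subset_def hD)).resolve_right (H D hD)
  refine h1.antisymm fun D hD => ?_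
  rcases hp.mem_or_compl_mem D (hq.subset_def hD) with h2 | h2
  · exact h2
  · exact absurd (h1 h2) (hq.compl_notMem hD)

/-- The cylinder over a set of `n`-tuples. -/
def cyl {α : Type*} {n : ℕ} (E : Set (Fin n → α)) : Set (Fin (n + 1) → α) :=
  {x | x ∘ Fin.castLE n.le_succ ∈ E}

theorem append_mem_cyl {α : Type*} {n : ℕ} {E : Set (Fin n → α)} {a : Fin n → α} {b : Fin 1 → α} :
    Fin.append a b ∈ cyl E ↔ a ∈ E := by
  have : Fin.append a b ∘ Fin.castLE n.le_succ = a := funext fun i => Fin.append_left a b i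
  rw [cyl, Set.mem_ofPred_eq, this]

theorem Str.cyl_solSet (θ : Formula σ) (c e : M.Val) :
    cyl (M.solSet h n θ e) =
      M.solSet h (n + 1) (θ.rename (shift h n (n + 1))) (Str.Val.merge (n + 1) c e) := by
  ext x
  rw [Str.mem_solSet, Formula.realize_rename (shift_injective n.le_succ),
    Str.Val.comap_set_merge n.le_succ le_rfl]
  rfl

theorem Str.cyl_mem_def {A : M.Params} {E : Set (Fin n → M.carrier h)} (hE : E ∈ M.Def h n A) :
    cyl E ∈ M.Def h (n + 1) A := by
  obtain ⟨θ, e, he, rfl⟩ := hE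
  exact ⟨_, _, fun z hz => Str.Val.merge_mem_params he n.le_succ le_rfl z hz.1 hz.2,
    Str.cyl_solSet θ e e⟩

/-- The restriction of a type to the first `n` variables. -/
def Str.restrictType (M : Str.{u, v, w} σ) (h : σ.Srt) (n : ℕ) (A : M.Params)
    (p : Set (Set (Fin (n + 1) → M.carrier h))) : Set (Set (Fin n → M.carrier h)) :=
  {E | E ∈ M.Def h n A ∧ cyl E ∈ p}

theorem Str.IsCompleteType.restrictType {A : M.Params}
    {p : Set (Set (Fin (n + 1) → M.carrier h))} (hp : M.IsCompleteType h (n + 1) A p) :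
    M.IsCompleteType h n A (M.restrictType h n A p) where
  subset_def _ hE := hE.1
  empty_notMem h0 := hp.empty_notMem h0.2
  inter_mem D hD E hE := ⟨Str.Def.inter hD.1 hE.1, hp.inter_mem _ hD.2 _ hE.2⟩
  mem_of_subset D hD E hE hDE :=
    ⟨hE, hp.mem_of_subset _ hD.2 _ (Str.cyl_mem_def hE) fun _ hx => hDE hx⟩
  mem_or_compl_mem D hD := by
    rcases hp.mem_or_compl_mem _ (Str.cyl_mem_def hD) with h1 | h1
    · exact Or.inl ⟨hD, h1⟩
    · exact Or.inr ⟨Str.Def.compl hD, h1⟩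

/-- The base `E` itself serves as `F`: for an ultrafilter not containing `E`, almost all fibres of
the cylinder are empty. -/
theorem VPreschema.IsIdealSchema.cyl_mem_prodIdeal
    (hI : VPreschema.IsIdealSchema.{u, v, w} I T) (hM : M.IsModel T)
    {K : Set (Set (Fin n → M.carrier h))} (hK : M.IsIdeal h n K) {E : Set (Fin n → M.carrier h)}
    (hE : E ∈ K) : cyl E ∈ M.prodIdeal K I := by
  refine ⟨Str.cyl_mem_def (hK.subset_def hE), E, hE, fun 𝒰 h1 => ?_⟩
  by_contra hE𝒰
  refine h1 ?_
  have h2 : ∀ᶠ a in (𝒰 : Filter _), fibre (cyl E) a = ∅ := by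
    filter_upwards [Ultrafilter.compl_mem_iff_notMem.2 hE𝒰] with a ha
    exact Set.eq_empty_of_forall_notMem fun b hb => ha (append_mem_cyl.1 hb)
  rw [Str.genericFibre, Str.star_empty 𝒰 h2]
  exact (hI _ (hM.ultrapower 𝒰)).2.empty_mem

theorem VPreschema.IsIdealSchema.restrictType_mem
    (hI : VPreschema.IsIdealSchema.{u, v, w} I T) (hJ : VPreschema.IsIdealSchema.{u, v, w} J T)
    (hM : M.IsModel T) {A : M.Params} {p : Set (Set (Fin (n + 1) → M.carrier h))}
    (hp : p ∈ M.wideTypes h (n + 1) ((J.prod I).points M) A) :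
    M.restrictType h n A p ∈ M.wideTypes h n (J.points M) A := by
  refine ⟨hp.1.restrictType, Set.disjoint_left.2 fun E hE hEJ => ?_⟩
  refine Set.disjoint_left.1 hp.2 hE.2 ?_
  rw [hI.points_prod hJ hM]
  exact hI.cyl_mem_prodIdeal hM (hJ M hM).2 hEJ

/-- Each condition `θ` for wideness of the fibre of `D` must belong to the restriction of `p`.
Otherwise `p` contains the part of `D` lying over the failure of `θ`. But no generic fibre of this
part is wide: it is empty if the ultrafilter contains `θ`, and otherwise it lies in the generic
fibre of `D`, which is not wide. So the part is in the product ideal, contrary to wideness of `p`.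
-/
theorem VPreschema.IsIdealSchema.genericFibre_notMem
    (hI : VPreschema.IsIdealSchema.{u, v, w} I T) (hJ : VPreschema.IsIdealSchema.{u, v, w} J T)
    (hM : M.IsModel T) {A : M.Params} {p : Set (Set (Fin (n + 1) → M.carrier h))}
    (hp : p ∈ M.wideTypes h (n + 1) ((J.prod I).points M) A)
    {𝒰 : Ultrafilter (Fin n → M.carrier h)} (h𝒰 : ∀ E ∈ M.restrictType h n A p, E ∈ 𝒰)
    {D : Set (Fin (n + 1) → M.carrier h)} (hD : D ∈ p) :
    Str.genericFibre 𝒰 D ∉ I.points (M.ultrapower 𝒰) := by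
  obtain ⟨ψ, e, he, rfl⟩ := hp.1.subset_def hD
  rw [hI.genericFibre_mem hM]
  intro θ hθ
  have hfv := I.fv_fibreWide hθ
  have hθA : M.solSet h n θ e ∈ M.Def h n A := by
    refine ⟨θ, e, fun z hz => he z ⟨(hfv hz.1).1, fun hzc => ?_⟩, rfl⟩
    obtain ⟨s, i⟩ := z
    have ⟨hs, hi⟩ : s = h ∧ i < n + 1 := hzc
    subst hs
    rcases Nat.lt_succ_iff_lt_or_eq.1 hi with hin | rfl
    · exact hz.2 ⟨rfl, hin⟩
    · exact (hfv hz.1).2 rfl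
  refine h𝒰 _ ⟨hθA, ?_⟩
  refine (hp.1.mem_or_compl_mem _ (Str.cyl_mem_def hθA)).resolve_right fun h1 => ?_
  have h2 := hp.1.inter_mem _ hD _ h1
  refine Set.disjoint_left.1 hp.2 h2 ?_
  rw [hI.points_prod hJ hM]
  refine ⟨Str.Def_subset_univ (hp.1.subset_def h2), ∅, (hJ M hM).2.empty_mem, fun 𝒱 h3 => ?_⟩
  exfalso
  by_cases h4 : M.solSet h n θ e ∈ 𝒱
  · refine h3 ?_
    have h5 : ∀ᶠ a in (𝒱 : Filter _),
        fibre (M.solSet h (n + 1) ψ e ∩ (cyl (M.solSet h n θ e))ᶜ) a = ∅ := by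
      filter_upwards [h4] with a ha
      exact Set.eq_empty_of_forall_notMem fun b hb => hb.2 (append_mem_cyl.2 ha)
    rw [Str.genericFibre, Str.star_empty 𝒱 h5]
    exact (hI _ (hM.ultrapower 𝒱)).2.empty_mem
  · refine h4 ((hI.genericFibre_mem hM 𝒱 ψ e).1 (fun h5 => h3 ?_) θ hθ)
    refine (hI _ (hM.ultrapower 𝒱)).2.mem_of_subset _ h5 _ ?_
      (Str.genericFibre_mono 𝒱 Set.inter_subset_left)
    exact Str.genericFibre_mem_def 𝒱 (Str.Def_subset_univ (hp.1.subset_def h2))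

/-- The parameter set `A` together with the generic point of an ultrafilter on `n`-tuples. -/
def Str.genericParams (𝒰 : Ultrafilter (Fin n → M.carrier h)) (A : M.Params) :
    (M.ultrapower 𝒰).Params :=
  Set.range (Sum.elim (fun x : A => ⟨x.1.1, Str.germ 𝒰 fun _ => x.1.2⟩)
    (fun k : Fin n => ⟨h, Str.germ 𝒰 fun a => a k⟩))

theorem Str.genericFibre_mem_def_genericParams (𝒰 : Ultrafilter (Fin n → M.carrier h))
    {A : M.Params} {D : Set (Fin (n + 1) → M.carrier h)} (hD : D ∈ M.Def h (n + 1) A) :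
    Str.genericFibre 𝒰 D ∈ (M.ultrapower 𝒰).Def h 1 (Str.genericParams 𝒰 A) := by
  obtain ⟨ψ, e, he, rfl⟩ := hD
  refine ⟨_, _, ?_, Str.genericFibre_solSet 𝒰 ψ e⟩
  rintro z ⟨hz, hzc⟩
  rw [Formula.fv_rename (swap_injective h n)] at hz
  obtain ⟨⟨s, i⟩, hy, rfl⟩ := hz
  have h1 : (Str.Val.germ 𝒰 (fun a => (e.set a).comap (swap h n)) (Var.map (swap h n) (s, i)) :
      (M.ultrapower 𝒰).carrier s) = Str.germ 𝒰 fun a => e.set a (s, i) := by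
    refine congrArg (Str.germ 𝒰) (funext fun a => ?_)
    exact Str.Val.apply_congr _ (swap_swap h n s i)
  have h2 : (⟨s, Str.germ 𝒰 fun a => e.set a (s, i)⟩ : Σ s, (M.ultrapower 𝒰).carrier s) ∈
      Str.genericParams 𝒰 A := by
    by_cases hc : ((s, i) : Var σ) ∈ ctx h n
    · have ⟨hs, hi⟩ : s = h ∧ i < n := hc
      subst hs
      simp only [Str.Val.set_apply _ _ hi]
      exact ⟨Sum.inr ⟨i, hi⟩, rfl⟩
    · simp only [Str.Val.set_of_notMem _ _ hc]
      refine ⟨Sum.inl ⟨⟨s, e (s, i)⟩, he _ ⟨hy, fun hc' => hzc ?_⟩⟩, rfl⟩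
      have ⟨hs, hi⟩ : s = h ∧ i < n + 1 := hc'
      subst hs
      rcases Nat.lt_succ_iff_lt_or_eq.1 hi with hin | rfl
      · exact absurd ⟨rfl, hin⟩ hc
      · exact ⟨rfl, by simp [Var.map, swap_self]⟩
  rw [← h1] at h2
  exact h2

/-- Wide types with a given restriction inject into the wide `1`-types over its realization. -/
theorem VPreschema.IsIdealSchema.mk_restrictType_le
    (hI : VPreschema.IsIdealSchema.{u, v, w} I T) (hJ : VPreschema.IsIdealSchema.{u, v, w} J T)
    (hM : M.IsModel T) (A : M.Params) {q : Set (Set (Fin n → M.carrier h))}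
    {𝒰 : Ultrafilter (Fin n → M.carrier h)} (h𝒰 : ∀ E ∈ q, E ∈ 𝒰) :
    Cardinal.mk {p // p ∈ M.wideTypes h (n + 1) ((J.prod I).points M) A ∧
      M.restrictType h n A p = q} ≤
    Cardinal.mk ((M.ultrapower 𝒰).wideTypes h 1 (I.points (M.ultrapower 𝒰))
      (Str.genericParams 𝒰 A)) := by
  have H : ∀ p : {p // p ∈ M.wideTypes h (n + 1) ((J.prod I).points M) A ∧
      M.restrictType h n A p = q}, ∃ r ∈ (M.ultrapower 𝒰).wideTypes h 1
        (I.points (M.ultrapower 𝒰)) (Str.genericParams 𝒰 A),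
        ∀ D : p.1, Str.genericFibre 𝒰 D.1 ∈ r := by
    rintro ⟨p, hp, rfl⟩
    have hN := (hI _ (hM.ultrapower 𝒰)).2
    refine hN.exists_wideType (fun D : p => Str.genericFibre 𝒰 D.1)
      (fun D => Str.genericFibre_mem_def_genericParams 𝒰 (hp.1.subset_def D.2)) fun t E hE h1 => ?_
    -- As `p` is closed under intersection, finitely many generic fibres reduce to one.
    have : ∃ D ∈ p, Str.genericFibre 𝒰 D ⊆ {a | ∀ i ∈ t, a ∈ Str.genericFibre 𝒰 i.1} := by
      clear h1
      induction t with
      | nil => exact ⟨_, hp.1.univ_mem, by simp⟩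
      | cons D t ih =>
        obtain ⟨D', hD', h2⟩ := ih
        refine ⟨D.1 ∩ D', hp.1.inter_mem _ D.2 _ hD', ?_⟩
        rw [Str.genericFibre_inter]
        intro a ha
        simp only [List.mem_cons, forall_eq_or_imp, Set.mem_ofPred_eq]
        exact ⟨ha.1, h2 ha.2⟩
    obtain ⟨D, hD, h2⟩ := this
    refine hI.genericFibre_notMem hJ hM hp h𝒰 hD (hN.mem_of_subset E hE _ ?_ (h2.trans h1))
    exact Str.genericFibre_mem_def 𝒰 (Str.Def_subset_univ (hp.1.subset_def hD))
  choose r hr hr' using H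
  refine Cardinal.mk_le_of_injective (f := fun p => ⟨r p, hr p⟩) fun p p' hpp => ?_
  have hpp' : r p = r p' := congrArg Subtype.val hpp
  -- A set separating the two types would put its generic fibre and the complement of that fibre
  -- into the same 1-type.
  refine Subtype.ext (p.2.1.1.eq_of_forall p'.2.1.1 fun D hD hD' => ?_)
  have h1 := hr' p ⟨D, hD⟩
  have h2 := hr' p' ⟨_, hD'⟩
  rw [hpp'] at h1
  rw [Str.genericFibre_compl] at h2
  exact (hr p').1.compl_notMem h1 h2

end WideStability

/-! ### Counting formulas and wide types; trees and uniform definability -/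

namespace WideStability

variable {σ : Signature.{u, v}}

/-! ### Cardinality of the set of formulas -/

/-- Formulas are counted through their universal closures: the length of the quantifier prefix is
enough to recover the formula. -/
theorem Formula.alls_injective {l l' : List (Var σ)} {φ φ' : Formula σ}
    (hl : l.length = l'.length) (H : Formula.alls l φ = Formula.alls l' φ') : φ = φ' := by
  induction l generalizing l' with
  | nil =>
    cases l' with
    | nil => exact H
    | cons z l' => simp at hl
  | cons y l ih =>
    cases l' with
    | nil => simp at hl
    | cons z l' =>
      simp only [List.length_cons, Nat.add_right_cancel_iff] at hl
      simp only [Formula.alls, Formula.all.injEq] at H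
      exact ih hl H.2.2

/-- The universal closure. -/
noncomputable def Formula.closure (φ : Formula σ) : Sentence σ :=
  ⟨Formula.alls φ.finite_fv.toFinset.toList φ, by
    rw [Formula.fv_alls, Set.sdiff_eq_empty]
    intro z hz
    simpa using hz⟩

instance Sentence.infinite : Infinite (Sentence σ) := by
  let f : ℕ → Sentence σ := fun k => Nat.rec ⟨.falsum, rfl⟩ (fun _ φ => φ.neg) k
  refine Infinite.of_injective f ?_
  have hs : ∀ k, (f (k + 1)).1 = (f k).1.neg := fun k => rfl
  intro i
  induction i with
  | zero =>
    rintro (_ | j) hj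
    · rfl
    · have := congrArg Subtype.val hj
      rw [hs] at this
      simp [f, Formula.neg] at this
  | succ i ih =>
    rintro (_ | j) hj
    · have := congrArg Subtype.val hj
      rw [hs] at this
      simp [f, Formula.neg] at this
    · have := congrArg Subtype.val hj
      rw [hs, hs] at this
      simp only [Formula.neg, Formula.imp.injEq, and_true] at this
      rw [ih (Subtype.ext this)]

/-- A sentence goes to itself or to its negation, whichever is in `T`, and the Boolean records the
case. So `T` has as many elements as there are sentences, up to a factor of two. -/
theorem Theory.exists_embedding {T : Theory σ} (hT : ∀ φ : Sentence σ, φ ∈ T ∨ φ.neg ∈ T) :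
    Nonempty (Sentence σ ↪ T × Bool) := by
  classical
  refine ⟨fun φ => if hφ : φ ∈ T then (⟨φ, hφ⟩, true)
    else (⟨_, (hT φ).resolve_left hφ⟩, false), ?_⟩
  intro φ ψ H
  by_cases hφ : φ ∈ T <;> by_cases hψ : ψ ∈ T <;> simp [hφ, hψ] at H
  · exact H
  · have := congrArg Subtype.val H
    simp only [Sentence.neg, Formula.neg, Formula.imp.injEq, and_true] at this
    exact Subtype.ext this

theorem Theory.infinite {T : Theory σ} (hT : ∀ φ : Sentence σ, φ ∈ T ∨ φ.neg ∈ T) :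
    Infinite T := by
  obtain ⟨f⟩ := Theory.exists_embedding hT
  have h1 : Infinite (T × Bool) := Infinite.of_injective f f.injective
  by_contra h2
  rw [not_infinite_iff_finite] at h2
  exact not_finite (T × Bool)

theorem Theory.mk_formula_le {T : Theory σ} (hT : ∀ φ : Sentence σ, φ ∈ T ∨ φ.neg ∈ T) :
    Cardinal.mk (Formula σ) ≤ Cardinal.mk T := by
  obtain ⟨f⟩ := Theory.exists_embedding hT
  have := Theory.infinite hT
  have hω : Cardinal.aleph0 ≤ Cardinal.mk T := Cardinal.infinite_iff.1 this
  have h1 : Function.Injective fun φ : Formula σ =>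
      (f φ.closure, φ.finite_fv.toFinset.toList.length) := by
    intro φ ψ H
    simp only [Prod.mk.injEq] at H
    exact Formula.alls_injective H.2 (congrArg Subtype.val (f.injective H.1))
  refine (Cardinal.mk_le_of_injective h1).trans ?_
  simp only [Cardinal.mk_prod, Cardinal.mk_bool, Cardinal.lift_ofNat,
    Cardinal.mk_nat, Cardinal.lift_aleph0, Cardinal.lift_uzero]
  refine (mul_le_mul' (mul_le_mul' le_rfl
    ((Cardinal.ofNat_lt_aleph0 (n := 2)).le.trans hω)) hω).trans ?_
  rw [Cardinal.mul_eq_self hω, Cardinal.mul_eq_self hω]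

/-- The variable bound by the outermost quantifier, if any. -/
def Formula.headVar (d : Var σ) : Formula σ → Var σ
  | .all s i _ => (s, i)
  | _ => d

/-! ### Counting types -/

variable {h : σ.Srt} {n : ℕ}

theorem mk_le_of_power_le {α : Type w} {κ : Cardinal.{w}}
    (hF : κ ^ Cardinal.mk α ≤ κ) (hκ : Cardinal.aleph0 ≤ κ) : Cardinal.mk α ≤ κ :=
  (Cardinal.cantor _).le.trans
    ((Cardinal.power_le_power_right (((Cardinal.ofNat_lt_aleph0 (n := 2)).le.trans hκ))).trans hF)

/-- A definable set is determined by a formula and the values of its parameter variables. -/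
theorem Str.mk_def_le {M : Str.{u, v, max u v w} σ} {A : M.Params} {κ : Cardinal.{max u v w}}
    (hκ : Cardinal.aleph0 ≤ κ) (hF : κ ^ Cardinal.mk (ULift.{w} (Formula σ)) ≤ κ)
    (hA : Cardinal.mk A ≤ κ) : Cardinal.mk (M.Def h n A) ≤ κ := by
  classical
  have hD : ∀ D : M.Def h n A, ∃ (φ : Formula σ) (e : M.Val),
      (∀ z ∈ φ.fv \ ctx h n, (⟨z.1, e z⟩ : Σ s, M.carrier s) ∈ A) ∧ D.1 = M.solSet h n φ e :=
    fun D => D.2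
  choose φ e he hDe using hD
  let g : M.Val → Var σ → Option A := fun e z =>
    if hz : (⟨z.1, e z⟩ : Σ s, M.carrier s) ∈ A then some ⟨_, hz⟩ else none
  -- Variables are indexed by formulas, each variable `z` being the head variable of `∀ z, ⊥`; so
  -- the hypothesis on powers of `κ` also bounds the number of assignments.
  let f : M.Def h n A → ULift.{w} (Formula σ) × (ULift.{w} (Formula σ) → Option A) := fun D =>
    (⟨φ D⟩, fun ψ => g (e D) (ψ.down.headVar (h, 0)))
  have hf : Function.Injective f := by
    intro D E H
    simp only [f, Prod.mk.injEq, ULift.up.injEq] at H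
    obtain ⟨h1, h2⟩ := H
    apply Subtype.ext
    rw [hDe D, hDe E, ← h1]
    refine Str.solSet_congr _ fun z hz => ?_
    have h3 : g (e D) z = g (e E) z := congrFun h2 ⟨.all z.1 z.2 .falsum⟩
    have h4 := he D z hz
    have h5 := he E z (h1 ▸ hz)
    simp only [g] at h3
    rw [dif_pos h4, dif_pos h5] at h3
    simpa using h3
  refine (Cardinal.mk_le_of_injective hf).trans ?_
  rw [Cardinal.mk_prod, Cardinal.lift_id, Cardinal.lift_id, ← Cardinal.power_def,
    Cardinal.mk_option]
  refine (mul_le_mul' (mk_le_of_power_le hF hκ) (Cardinal.power_le_power_right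
    (add_le_add hA (Cardinal.one_lt_aleph0.le.trans hκ)))).trans ?_
  rw [Cardinal.add_eq_self hκ]
  exact (mul_le_mul' le_rfl hF).trans (Cardinal.mul_eq_self hκ).le

/-- For each `φ` a wide type has a least rank `m` among its members, attained at some `F`. If
another type has the same `m` and `F` but disagrees about an instance of `φ`, both halves of `F`
have rank at least `m`, so `F` has rank at least `m + 1`. Hence the choices of `m` and `F` determine
the type. -/
theorem Str.mk_wideTypes_le {M : Str.{u, v, max u v w} σ} {A : M.Params}
    {K : Set (Set (Fin n → M.carrier h))} {κ : Cardinal.{max u v w}}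
    (hκ : Cardinal.aleph0 ≤ κ) (hF : κ ^ Cardinal.mk (ULift.{w} (Formula σ)) ≤ κ)
    (hA : Cardinal.mk A ≤ κ)
    (hK : ∀ φ : Formula σ, ∃ m, ¬ M.RankGE h n K φ m Set.univ) :
    Cardinal.mk (M.wideTypes h n K A) ≤ κ := by
  classical
  have key : ∀ (p : M.wideTypes h n K A) (φ : Formula σ), ∃ x : ULift.{max u v w} ℕ × M.Def h n A,
      x.2.1 ∈ p.1 ∧ ¬ M.RankGE h n K φ (x.1.down + 1) x.2.1 ∧
        ∀ E ∈ p.1, M.RankGE h n K φ x.1.down E := by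
    intro p φ
    have hex : ∃ k, ∃ D ∈ p.1, ¬ M.RankGE h n K φ k D :=
      (hK φ).imp fun m hm => ⟨_, p.2.1.univ_mem, hm⟩
    obtain ⟨D, hD, hDk⟩ := Nat.find_spec hex
    have hmin := fun m => Nat.find_min hex (m := m)
    -- The least bound that fails is not zero, because members of a wide type are outside of the
    -- ideal.
    cases hk : Nat.find hex with
    | zero =>
      rw [hk] at hDk
      exact absurd (Set.disjoint_left.1 p.2.2 hD) hDk
    | succ m =>
      rw [hk] at hDk
      refine ⟨(⟨m⟩, ⟨D, p.2.1.subset_def hD⟩), hD, hDk, fun E hE => ?_⟩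
      by_contra hEm
      exact hmin m (by omega) ⟨E, hE, hEm⟩
  choose F hF1 hF2 hF3 using key
  let f : M.wideTypes h n K A → ULift.{w} (Formula σ) → ULift.{max u v w} ℕ × M.Def h n A :=
    fun p φ => F p φ.down
  have hf : Function.Injective f := by
    intro p q H
    refine Subtype.ext (p.2.1.eq_of_forall q.2.1 fun D hD hD' => ?_)
    obtain ⟨φ, e, -, rfl⟩ := p.2.1.subset_def hD
    have h1 : F p φ = F q φ := congrFun H ⟨φ⟩
    refine hF2 p φ ⟨e, hF3 p φ _ (p.2.1.inter_mem _ (hF1 p φ) _ hD), ?_⟩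
    rw [h1]
    exact hF3 q φ _ (q.2.1.inter_mem _ (hF1 q φ) _ hD')
  refine (Cardinal.mk_le_of_injective hf).trans ?_
  rw [← Cardinal.power_def, Cardinal.mk_prod, Cardinal.lift_id, Cardinal.lift_id,
    Cardinal.mk_uLift, Cardinal.mk_nat, Cardinal.lift_aleph0]
  refine (Cardinal.power_le_power_right ((mul_le_mul' hκ (Str.mk_def_le hκ hF hA)).trans
    (Cardinal.mul_eq_self hκ).le)).trans hF

/-! ### Trees of instances -/

/-- A set or its complement. -/
def side {α : Type*} : Bool → Set α → Set α
  | true, X => X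
  | false, X => Xᶜ

theorem side_mem_def {M : Str.{u, v, w} σ} {A : M.Params} {D : Set (Fin n → M.carrier h)}
    (hD : D ∈ M.Def h n A) (b : Bool) : side b D ∈ M.Def h n A := by
  cases b
  · exact Str.Def.compl hD
  · exact hD

/-- The intersection along a branch of a binary tree of instances of `φ`. -/
def Str.branch (M : Str.{u, v, w} σ) (h : σ.Srt) (n : ℕ) (φ : Formula σ) :
    (List Bool → M.Val) → List Bool → Set (Fin n → M.carrier h)
  | _, [] => Set.univ
  | c, b :: l => side b (M.solSet h n φ (c [])) ∩ M.branch h n φ (fun s => c (b :: s)) l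

theorem Str.branch_subset {M : Str.{u, v, w} σ} (φ : Formula σ) (c : List Bool → M.Val)
    (l₁ l₂ : List Bool) (b : Bool) :
    M.branch h n φ c (l₁ ++ b :: l₂) ⊆ side b (M.solSet h n φ (c l₁)) := by
  induction l₁ generalizing c with
  | nil => exact Set.inter_subset_left
  | cons b' l₁ ih => exact Set.inter_subset_right.trans (ih fun s => c (b' :: s))

/-- Unfolding the recursion of the rank yields a full binary tree of height `m`, the empty list
being its root. Stating wideness of a branch as not being covered by a set of `K` makes definability
of the branch irrelevant. -/
theorem Str.RankGE.exists_tree {M : Str.{u, v, w} σ} {K : Set (Set (Fin n → M.carrier h))}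
    (hK : M.IsIdeal h n K) {φ : Formula σ} {m : ℕ} {D : Set (Fin n → M.carrier h)}
    (hD : D ∈ M.Def h n Set.univ) (H : M.RankGE h n K φ m D) :
    ∃ c : List Bool → M.Val, ∀ l, l.length = m → ∀ E ∈ K, ¬ D ∩ M.branch h n φ c l ⊆ E := by
  induction m generalizing D with
  | zero =>
    obtain ⟨e⟩ := Str.Val.nonempty M
    refine ⟨fun _ => e, fun l hl E hE hsub => H ?_⟩
    rw [List.length_eq_zero_iff.1 hl, Str.branch, Set.inter_univ] at hsub
    exact hK.mem_of_subset E hE D hD hsub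
  | succ m ih =>
    obtain ⟨c, h1, h2⟩ := H
    have h3 : ∀ b, M.RankGE h n K φ m (D ∩ side b (M.solSet h n φ c)) := by
      rintro (_ | _)
      · exact h2
      · exact h1
    choose d hd using fun b =>
      ih (Str.Def.inter hD (side_mem_def (Str.solSet_mem_def φ c) b)) (h3 b)
    refine ⟨fun | [] => c | b :: s => d b s, ?_⟩
    rintro (_ | ⟨b, l⟩) hl E hE
    · simp at hl
    · rw [Str.branch, ← Set.inter_assoc]
      exact hd b l (by simpa using hl) E hE

/-- Families of sets defined by instances of one formula. -/
def Str.UniformlyDef (M : Str.{u, v, w} σ) (h : σ.Srt) (n : ℕ) {ι : Type*}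
    (D : ι → Set (Fin n → M.carrier h)) : Prop :=
  ∃ (ψ : Formula σ) (e : ι → M.Val), ∀ i, D i = M.solSet h n ψ (e i)

section

variable {M : Str.{u, v, w} σ} {ι : Type w} {D E : ι → Set (Fin n → M.carrier h)}

theorem Str.UniformlyDef.inter (hD : M.UniformlyDef h n D) (hE : M.UniformlyDef h n E) :
    M.UniformlyDef h n fun i => D i ∩ E i := by
  obtain ⟨φ, c, hc⟩ := hD
  obtain ⟨ψ, d, hd⟩ := hE
  obtain ⟨N, hN, hφ⟩ := φ.exists_bound n
  refine ⟨φ.and (ψ.rename (shift h n N)), fun i => Str.Val.merge N (c i) (d i), fun i => ?_⟩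
  rw [Str.solSet_and, Str.solSet_rename_merge hN, Str.solSet_merge hφ, ← hc, ← hd]

theorem Str.UniformlyDef.side (hD : M.UniformlyDef h n D) (b : Bool) :
    M.UniformlyDef h n fun i => side b (D i) := by
  obtain ⟨φ, c, hc⟩ := hD
  cases b
  · exact ⟨φ.neg, c, fun i => by rw [Str.solSet_neg, ← hc]; rfl⟩
  · exact ⟨φ, c, hc⟩

theorem Str.uniformlyDef_univ : M.UniformlyDef h n fun _ : ι => Set.univ := by
  obtain ⟨e⟩ := Str.Val.nonempty M
  exact ⟨Formula.falsum.neg, fun _ => e, fun i => by ext; simp [Str.solSet, Formula.Realize]⟩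

theorem Str.star_side (𝒰 : Ultrafilter ι) (b : Bool) :
    Str.star 𝒰 (fun i => WideStability.side b (D i)) = WideStability.side b (Str.star 𝒰 D) := by
  cases b
  · exact Str.star_compl 𝒰 D
  · rfl

/-- Uniformity is essential: a single set of formulas then expresses wideness of all members of the
family, and Łoś's theorem transfers each of these formulas. -/
theorem Str.UniformlyDef.star_notMem {T : Theory σ} {J : VPreschema σ h n}
    (hJ : VPreschema.IsIdealSchema.{u, v, w} J T) (hM : M.IsModel T) (𝒰 : Ultrafilter ι)
    (hD : M.UniformlyDef h n D) (H : ∀ᶠ i in (𝒰 : Filter ι), D i ∉ J.points M) :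
    Str.star 𝒰 D ∉ J.points (M.ultrapower 𝒰) := by
  obtain ⟨ψ, e, he⟩ := hD
  obtain rfl : D = fun i => M.solSet h n ψ (e i) := funext he
  refine (hJ.star_mem_points hM 𝒰 ψ e).2 fun θ hθ => H.mono fun i hi => ?_
  rw [(hJ M hM).1.solSet_mem_points, not_not] at hi
  exact hi θ hθ

theorem Str.UniformlyDef.forall_mem {α : Type*} {s : α → ι → Set (Fin n → M.carrier h)}
    (hs : ∀ b, M.UniformlyDef h n (s b)) (𝒰 : Ultrafilter ι) (t : List α) :
    M.UniformlyDef h n (fun i => {a | ∀ b ∈ t, a ∈ s b i}) ∧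
      Str.star 𝒰 (fun i => {a | ∀ b ∈ t, a ∈ s b i}) = {a | ∀ b ∈ t, a ∈ Str.star 𝒰 (s b)} := by
  induction t with
  | nil =>
    simp only [List.not_mem_nil, IsEmpty.forall_iff, implies_true]
    refine ⟨Str.uniformlyDef_univ, Str.star_ext 𝒰 fun a => ?_⟩
    simp
  | cons b t ih =>
    have h1 : (fun i => {a | ∀ b' ∈ b :: t, a ∈ s b' i}) =
        fun i => s b i ∩ {a | ∀ b ∈ t, a ∈ s b i} := by
      funext i
      ext a
      simp
    rw [h1]
    refine ⟨(hs b).inter ih.1, ?_⟩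
    rw [Str.star_inter, ih.2]
    ext a
    simp

end

end WideStability

/-! ### From instability to many types, and from one variable to several -/

namespace WideStability

variable {σ : Signature.{u, v}} {h : σ.Srt} {n : ℕ}

/-- A well-order with more than `κ` branches but at most `κ` nodes in the binary tree over it. -/
theorem exists_tree_order (κ : Cardinal.{w}) (hκ : Cardinal.aleph0 ≤ κ) :
    ∃ (Λ : Type w) (_ : LinearOrder Λ) (_ : WellFoundedLT Λ),
      κ < Cardinal.mk (Λ → Bool) ∧ Cardinal.mk (Σ b : Λ, (Set.Iio b → Bool)) ≤ κ := by
  -- Minimality gives `μ ≤ κ`, and at most `κ` nodes on each of the `μ` levels, because proper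
  -- initial segments of the initial ordinal of `μ` have size less than `μ`.
  obtain ⟨μ, hμ, hmin⟩ := Cardinal.lt_wf.has_min {μ : Cardinal.{w} | κ < 2 ^ μ}
    ⟨κ, Cardinal.cantor κ⟩
  refine ⟨μ.ord.ToType, inferInstance, inferInstance, ?_, ?_⟩
  · simpa using hμ
  · rw [Cardinal.mk_sigma]
    have h1 : ∀ b : μ.ord.ToType, Cardinal.mk (Set.Iio b → Bool) ≤ κ := fun b => by
      have hb : Cardinal.mk (Set.Iio b) < μ :=
        (Cardinal.mk_Iio_lt b (by simp)).trans_eq (Cardinal.mk_ord_toType μ)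
      have h2 : ¬ κ < 2 ^ Cardinal.mk (Set.Iio b) := fun h3 => hmin _ h3 hb
      simpa using not_lt.1 h2
    refine (Cardinal.sum_le_sum _ _ h1).trans ?_
    rw [Cardinal.sum_const', Cardinal.mk_ord_toType]
    have h2 : μ ≤ κ := by
      by_contra h2
      exact hmin κ (Cardinal.cantor κ) (not_le.1 h2)
    exact (mul_le_mul' h2 le_rfl).trans (Cardinal.mul_eq_self hκ).le

theorem filter_lt_append {Λ : Type*} [LinearOrder Λ] {l₁ l₂ : List Λ} {b : Λ}
    (hl : (l₁ ++ b :: l₂).Pairwise (· < ·)) : (l₁ ++ b :: l₂).filter (· < b) = l₁ := by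
  rw [List.pairwise_append] at hl
  obtain ⟨-, h2, h3⟩ := hl
  rw [List.pairwise_cons] at h2
  rw [List.filter_append, List.filter_cons_of_neg (by simp),
    List.filter_eq_self.2 (fun a ha => by simpa using h3 a ha b (by simp)),
    List.filter_eq_nil_iff.2 (fun a ha => by simpa using (h2.1 a ha).le), List.append_nil]

/-- If `φ` is unstable then some set of at most `κ` parameters has more than `κ` wide types. -/
theorem VPreschema.IsIdealSchema.exists_lt_mk_wideTypes {T : Theory σ} {J : VPreschema σ h n}
    (hJ : VPreschema.IsIdealSchema.{u, v, max u v w} J T) {M : Str.{u, v, max u v w} σ}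
    (hM : M.IsModel T) {φ : Formula σ} (hφ : ∀ m, M.RankGE h n (J.points M) φ m Set.univ)
    {κ : Cardinal.{max u v w}} (hκ : Cardinal.aleph0 ≤ κ)
    (hF : Cardinal.mk (ULift.{w} (Formula σ)) ≤ κ) :
    ∃ N : Str.{u, v, max u v w} σ, N.IsModel T ∧ ∃ A : N.Params, Cardinal.mk A ≤ κ ∧
      κ < Cardinal.mk (N.wideTypes h n (J.points N) A) := by
  classical
  obtain ⟨Λ, _, _, hΛ, hnode⟩ := exists_tree_order κ hκ
  choose c hc using fun m => (hφ m).exists_tree (hJ M hM).2 (Str.univ_mem_def _)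
  let node : (Λ → Bool) → Λ → Σ b : Λ, (Set.Iio b → Bool) := fun η b => ⟨b, fun γ => η γ⟩
  let ext : (x : Σ b : Λ, (Set.Iio b → Bool)) → Λ → Bool := fun x γ =>
    if hγ : γ < x.1 then x.2 ⟨γ, hγ⟩ else false
  -- Finite sets of levels index the ultrapower; almost all of them contain any given level.
  let 𝒰 : Ultrafilter (Finset Λ) := Ultrafilter.of Filter.atTop
  have h𝒰 : ∀ b : Λ, ∀ᶠ F in (𝒰 : Filter (Finset Λ)), b ∈ F := fun b =>
    Ultrafilter.of_le Filter.atTop ((Filter.eventually_ge_atTop {b}).mono fun F hF => by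
      simpa using hF)
  -- In component `F` a node is sent into the finite tree of height `|F|` by reading its values at
  -- the levels of `F` below it. Only such levels are read, so the default value in `ext` plays no
  -- role.
  let d : (Σ b : Λ, (Set.Iio b → Bool)) → Finset Λ → M.Val := fun x F =>
    c F.card ((F.sort.filter (· < x.1)).map (ext x))
  let N := M.ultrapower 𝒰
  have hN : N.IsModel T := hM.ultrapower 𝒰
  let s : (Λ → Bool) → Λ → Finset Λ → Set (Fin n → M.carrier h) := fun η b F =>
    side (η b) (M.solSet h n φ (d (node η b) F))
  have hs : ∀ η b, M.UniformlyDef h n (s η b) := fun η b =>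
    Str.UniformlyDef.side ⟨φ, d (node η b), fun _ => rfl⟩ _
  have hstar : ∀ η b, Str.star 𝒰 (s η b) =
      side (η b) (N.solSet h n φ (Str.Val.germ 𝒰 (d (node η b)))) := fun η b => by
    rw [← Str.star_solSet]
    exact Str.star_side 𝒰 _
  have hbranch : ∀ η b (F : Finset Λ), b ∈ F →
      M.branch h n φ (c F.card) (F.sort.map η) ⊆ s η b F := by
    intro η b F hb
    obtain ⟨l₁, l₂, hl⟩ := List.mem_iff_append.1 ((Finset.mem_sort (· ≤ ·)).2 hb)
    have hpw : (l₁ ++ b :: l₂).Pairwise (· < ·) := hl ▸ F.sortedLT_sort.pairwise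
    have h1 : d (node η b) F = c F.card (l₁.map η) := by
      simp only [d, node, hl]
      rw [filter_lt_append hpw]
      refine congrArg _ (List.map_congr_left fun γ hγ => ?_)
      have : γ < b := (List.pairwise_append.1 hpw).2.2 γ hγ b (by simp)
      simp [ext, this]
    simp only [s, h1, hl, List.map_append, List.map_cons]
    exact Str.branch_subset φ _ _ _ _
  -- The values of all node assignments at all variables, the variables being again indexed by
  -- formulas.
  let A : N.Params := Set.range fun x : (Σ b : Λ, (Set.Iio b → Bool)) × ULift.{w} (Formula σ) =>
    ⟨(x.2.down.headVar (h, 0)).1, Str.Val.germ 𝒰 (d x.1) (x.2.down.headVar (h, 0))⟩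
  have hA : Cardinal.mk A ≤ κ := by
    refine Cardinal.mk_range_le.trans ?_
    rw [Cardinal.mk_prod, Cardinal.lift_id, Cardinal.lift_id]
    exact (mul_le_mul' hnode hF).trans (Cardinal.mul_eq_self hκ).le
  have hdef : ∀ η b, Str.star 𝒰 (s η b) ∈ N.Def h n A := fun η b => by
    rw [hstar]
    have h1 : N.solSet h n φ (Str.Val.germ 𝒰 (d (node η b))) ∈ N.Def h n A :=
      ⟨φ, _, fun z _ => ⟨(node η b, ⟨.all z.1 z.2 .falsum⟩), rfl⟩, rfl⟩
    exact side_mem_def h1 _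
  have hex : ∀ η, ∃ p ∈ N.wideTypes h n (J.points N) A, ∀ b, Str.star 𝒰 (s η b) ∈ p := by
    intro η
    refine (hJ N hN).2.exists_wideType _ (hdef η) fun t E hE hsub => ?_
    obtain ⟨h1, h2⟩ := Str.UniformlyDef.forall_mem (hs η) 𝒰 t
    rw [← h2] at hsub
    refine h1.star_notMem hJ hM 𝒰 ?_ ((hJ N hN).2.mem_of_subset E hE _ ?_ hsub)
    · have : ∀ᶠ F in (𝒰 : Filter (Finset Λ)), ∀ b ∈ t, b ∈ F :=
        (Filter.eventually_all_finite (List.finite_toSet t)).2 fun b _ => h𝒰 b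
      refine this.mono fun F hF hmem => hc F.card (F.sort.map η) (by simp) _ hmem ?_
      rw [Set.univ_inter]
      exact fun a ha b hb => hbranch η b F (hF b hb) ha
    · obtain ⟨ψ, e, he⟩ := h1
      rw [funext he, Str.star_solSet]
      exact Str.solSet_mem_def _ _
  choose p hp hp' using hex
  refine ⟨N, hN, A, hA, hΛ.trans_le (Cardinal.mk_le_of_injective (f := fun η => ⟨p η, hp η⟩) ?_)⟩
  intro η η' hη
  have hpp : p η = p η' := congrArg Subtype.val hη
  -- At the first level where two branches differ they pass through the same node, so one type
  -- contains an instance of `φ` and the other its complement.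
  funext b
  induction b using WellFoundedLT.induction with
  | ind b ih =>
    by_contra hne
    have hnode : node η b = node η' b := by
      simp only [node, Sigma.mk.injEq, heq_eq_eq, true_and]
      exact funext fun γ => ih γ γ.2
    have h1 := hp' η b
    have h2 := hp' η' b
    rw [hpp, hstar, hnode] at h1
    rw [hstar] at h2
    generalize N.solSet h n φ (Str.Val.germ 𝒰 (d (node η' b))) = X at h1 h2
    cases h3 : η b <;> cases h4 : η' b <;> rw [h3] at h1 <;> rw [h4] at h2
    · exact hne (h3.trans h4.symm)
    · exact (hp η').1.compl_notMem h2 h1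
    · exact (hp η').1.compl_notMem h1 h2
    · exact hne (h3.trans h4.symm)

theorem Str.mk_genericParams_le {M : Str.{u, v, max u v w} σ}
    (𝒰 : Ultrafilter (Fin n → M.carrier h)) {A : M.Params} {κ : Cardinal.{max u v w}}
    (hκ : Cardinal.aleph0 ≤ κ) (hA : Cardinal.mk A ≤ κ) :
    Cardinal.mk (Str.genericParams 𝒰 A) ≤ κ := by
  have h1 := Cardinal.mk_range_le_lift (f := (Sum.elim
    (fun x : A => ⟨x.1.1, Str.germ 𝒰 fun _ => x.1.2⟩)
    (fun k : Fin n => ⟨h, Str.germ 𝒰 fun a => a k⟩) :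
      A ⊕ Fin n → Σ s, (M.ultrapower 𝒰).carrier s))
  rw [Cardinal.lift_id, Cardinal.lift_id] at h1
  refine h1.trans ?_
  rw [Cardinal.mk_sum]
  simp only [Cardinal.lift_uzero, Cardinal.mk_fin, Cardinal.lift_natCast]
  exact (add_le_add hA ((Cardinal.natCast_le_aleph0).trans hκ)).trans (Cardinal.add_eq_self hκ).le

/-- Bounds on the number of wide `1`-types give bounds on the number of wide `n`-types. -/
theorem VPreschema.IsIdealSchema.mk_wideTypes_pow_le {T : Theory σ} {I : VPreschema σ h 1}
    (hI : VPreschema.IsIdealSchema.{u, v, max u v w} I T) {κ : Cardinal.{max u v w}}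
    (hκ : Cardinal.aleph0 ≤ κ)
    (H : ∀ M : Str.{u, v, max u v w} σ, M.IsModel T → ∀ A : M.Params, Cardinal.mk A ≤ κ →
      Cardinal.mk (M.wideTypes h 1 (I.points M) A) ≤ κ)
    {M : Str.{u, v, max u v w} σ} (hM : M.IsModel T) {A : M.Params} (hA : Cardinal.mk A ≤ κ)
    (n : ℕ) : Cardinal.mk (M.wideTypes h (n + 1) ((I.pow n).points M) A) ≤ κ := by
  induction n with
  | zero => exact H M hM A hA
  | succ n ih =>
    let f : M.wideTypes h (n + 1 + 1) ((I.pow (n + 1)).points M) A →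
        M.wideTypes h (n + 1) ((I.pow n).points M) A :=
      fun p => ⟨M.restrictType h (n + 1) A p.1, hI.restrictType_mem (hI.pow n) hM p.2⟩
    -- At most `κ` restrictions, each with at most `κ` extensions: the latter inject into the wide
    -- 1-types of an ultrapower over `A` and a finite tuple.
    refine (Cardinal.mk_le_mk_mul_of_mk_preimage_le (c := κ) f fun q => ?_).trans
      ((mul_le_mul' ih le_rfl).trans (Cardinal.mul_eq_self hκ).le)
    obtain ⟨𝒰, h𝒰⟩ := q.2.1.exists_ultrafilter
    refine (Cardinal.mk_le_of_injective (f := fun p : f ⁻¹' {q} =>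
      (⟨p.1.1, p.1.2, congrArg Subtype.val p.2⟩ :
        {p // p ∈ M.wideTypes h (n + 1 + 1) (((I.pow n).prod I).points M) A ∧
          M.restrictType h (n + 1) A p = q.1})) ?_).trans
      ((hI.mk_restrictType_le (hI.pow n) hM A h𝒰).trans
        (H _ (hM.ultrapower 𝒰) _ (Str.mk_genericParams_le 𝒰 hκ hA)))
    intro p p' hpp
    exact Subtype.ext (Subtype.ext (congrArg (fun x => x.1) hpp))

/-- A formula is stable if the wide types over sets of size at most `κ = κ ^ |T|` are counted
by `κ`. -/
theorem VPreschema.IsIdealSchema.isStable_of_mk_wideTypes_le {T : Theory σ} {J : VPreschema σ h n}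
    (hT : ∀ φ : Sentence σ, φ ∈ T ∨ φ.neg ∈ T)
    (hJ : VPreschema.IsIdealSchema.{u, v, max u v w} J T)
    (H : ∀ κ : Cardinal.{max u v w}, Cardinal.aleph0 ≤ κ →
      κ = κ ^ Cardinal.lift.{w} (Cardinal.mk T) →
      ∀ M : Str.{u, v, max u v w} σ, M.IsModel T → ∀ A : M.Params,
        Cardinal.mk A ≤ κ → Cardinal.mk (M.wideTypes h n (J.points M) A) ≤ κ) (φ : Formula σ) :
    VPreschema.IsStable.{u, v, max u v w} J T φ := by
  intro M hM
  by_contra! hφ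
  have := Theory.infinite hT
  have hω : Cardinal.aleph0 ≤ Cardinal.lift.{w} (Cardinal.mk T) :=
    Cardinal.aleph0_le_lift.2 (Cardinal.infinite_iff.1 this)
  -- The cardinal used is `2 ^ |T|`, which is its own `|T|`-th power.
  have hω' := hω.trans (Cardinal.cantor _).le
  obtain ⟨N, hN, A, hA, hlt⟩ := hJ.exists_lt_mk_wideTypes hM hφ hω' (by
    rw [Cardinal.mk_uLift]
    exact (Cardinal.lift_le.2 (Theory.mk_formula_le hT)).trans (Cardinal.cantor _).le)
  exact hlt.not_ge (H _ hω' (by rw [← Cardinal.power_mul, Cardinal.mul_eq_self hω]) N hN A hA)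

theorem VPreschema.mk_wideTypes_le_of_isStable {T : Theory σ} {J : VPreschema σ h n}
    (hT : ∀ φ : Sentence σ, φ ∈ T ∨ φ.neg ∈ T)
    (H : ∀ φ : Formula σ, VPreschema.IsStable.{u, v, max u v w} J T φ)
    {κ : Cardinal.{max u v w}} (hκ : Cardinal.aleph0 ≤ κ)
    (hκT : κ = κ ^ Cardinal.lift.{w} (Cardinal.mk T)) {M : Str.{u, v, max u v w} σ}
    (hM : M.IsModel T) {A : M.Params} (hA : Cardinal.mk A ≤ κ) :
    Cardinal.mk (M.wideTypes h n (J.points M) A) ≤ κ := by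
  refine Str.mk_wideTypes_le hκ ?_ hA fun φ => H φ M hM
  conv_rhs => rw [hκT]
  refine Cardinal.power_le_power_left (Cardinal.aleph0_pos.trans_le hκ).ne' ?_
  rw [Cardinal.mk_uLift]
  exact Cardinal.lift_le.2 (Theory.mk_formula_le hT)

end WideStability

/-! ### The main theorem -/

theorem mainTheorem3 (σ : WideStability.Signature.{u, v}) (T : WideStability.Theory σ)
    (hT : WideStability.Theory.IsMaximal.{u, v, max u v w} T) (h : σ.Srt)
    (I : WideStability.VPreschema σ h 1)
    (hI : WideStability.VPreschema.IsIdealSchema.{u, v, max u v w} I T) :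
    -- the powers of `I` are again given by ideal schemas
    (∃ P : (n : ℕ) → WideStability.VPreschema σ h (n + 1),
      ∀ n, WideStability.VPreschema.IsIdealSchema.{u, v, max u v w} (P n) T ∧
        ∀ U : WideStability.Str.{u, v, max u v w} σ, U.IsModel T → U.IsOmegaSaturated →
          (P n).points U = U.fubiniPow h (I.points U) n) ∧
    -- the four conditions, for any choice `P n` of a schema that defines the power `n + 1` of `I`
    ∀ U : WideStability.Str.{u, v, max u v w} σ, U.IsModel T → U.IsOmegaSaturated →
    ∀ P : (n : ℕ) → WideStability.VPreschema σ h (n + 1),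
      (∀ n, WideStability.VPreschema.IsIdealSchema.{u, v, max u v w} (P n) T ∧
        (P n).points U = U.fubiniPow h (I.points U) n) →
      List.TFAE
        [ ∀ (n : ℕ) (φ : WideStability.Formula σ),
            WideStability.VPreschema.IsStable.{u, v, max u v w} (P n) T φ,
          ∀ φ : WideStability.Formula σ,
            WideStability.VPreschema.IsStable.{u, v, max u v w} I T φ,
          ∀ κ : Cardinal.{max u v w}, Cardinal.aleph0 ≤ κ →
            κ = κ ^ Cardinal.lift.{w} (Cardinal.mk T) →
            ∀ M : WideStability.Str.{u, v, max u v w} σ, M.IsModel T → ∀ A : M.Params,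
              Cardinal.mk A ≤ κ → Cardinal.mk (M.wideTypes h 1 (I.points M) A) ≤ κ,
          ∀ κ : Cardinal.{max u v w}, Cardinal.aleph0 ≤ κ →
            κ = κ ^ Cardinal.lift.{w} (Cardinal.mk T) →
            ∀ M : WideStability.Str.{u, v, max u v w} σ, M.IsModel T → ∀ A : M.Params,
              ∀ n : ℕ, Cardinal.mk A ≤ κ →
                Cardinal.mk (M.wideTypes h (n + 1) ((P n).points M) A) ≤ κ ] := by
  refine ⟨⟨I.pow, fun n => ⟨hI.pow n, fun U hU hUs => hI.points_pow hU hUs n⟩⟩, ?_⟩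
  intro U hU hUs P hP
  -- Agreement in the saturated model `U` passes to all models, since `T` is complete; so `P` may be
  -- replaced by the constructed powers.
  have hpts : ∀ (n : ℕ) (M : WideStability.Str.{u, v, max u v w} σ), M.IsModel T →
      (P n).points M = (I.pow n).points M := fun n M hM =>
    (hP n).1.points_eq (hI.pow n) hT.2 hUs hU
      ((hP n).2.trans (hI.points_pow hU hUs n).symm) hM
  have hpts₀ : ∀ M : WideStability.Str.{u, v, max u v w} σ, M.IsModel T →
      (P 0).points M = I.points M := hpts 0
  tfae_have 1 → 2 := fun H φ M hM => by
    rw [← hpts₀ M hM]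
    exact H 0 φ M hM
  tfae_have 2 → 3 := fun H κ hκ hκT M hM A hA =>
    WideStability.VPreschema.mk_wideTypes_le_of_isStable hT.2 H hκ hκT hM hA
  tfae_have 3 → 4 := fun H κ hκ hκT M hM A n hA => by
    rw [hpts n M hM]
    exact hI.mk_wideTypes_pow_le hκ (H κ hκ hκT) hM hA n
  tfae_have 4 → 1 := fun H n =>
    (hP n).1.isStable_of_mk_wideTypes_le hT.2 fun κ hκ hκT M hM A hA => H κ hκ hκT M hM A n hA
  tfae_finish
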